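/- Let $D=(-1,1)$, let $\varrho$ be the uniform probability measure on $D$, and for $n\ge 1$ let $\mathcal P=\mathbb P_{n-1}$ be the space of complex polynomials of degree less than $n$. Put $\sigma=\sigma(n)=(2^{1/n}-1)^2/16$ and let $\mu$ be the Chebyshev (arcsine) probability measure rescaled to $(-1+\sigma,1-\sigma)$, $$\mathrm d\mu(x)=\frac{1}{(1-\sigma)\pi}\Big(1-\big(\tfrac{x}{1-\sigma}\big)^2\Big)^{-1/2}\mathbb I_{(-1+\sigma,1-\sigma)}(x)\,\mathrm dx ,$$ with weight function $w=1/v$, $v=\mathrm d\mu/\mathrm d\varrho$. For a measurable cost function $c:D\to(0,\infty)$ and $m$ i.i.d. samples $x_1,\dots,x_m\sim\mu$, the expected cost is $C_{\mathsf{exp}}=\mathbb E\big(c(x_1)+\dots+c(x_m)\big)=m\int_D c\,\mathrm d\mu$. For $f\in L^2_\varrho(D)$ (complex valued) let $f_n\in\mathcal P$ be its best $L^2_\varrho(D)$-approximation, and for noise $e\in\mathbb C^m$ let $\hat f$ be a weighted least-squares estimator, i.e. a minimizer over $p\in\mathcal P$ of $\frac1m\sum_{i=1}^m w(x_i)\,|f(x_i)+e_i-p(x_i)|^2$.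 There are a universal constant $K>0$ and constants $C_\alpha$ depending only on $\alpha$ such that for all $n\ge1$ and $0<\epsilon<1$ there is a number of samples $m\ge \max\{n,\,8n\log(3n/\epsilon)\}$, depending only on $n$ and $\epsilon$, with the following two properties. 1. (Cost.) For every $\alpha\ge0$, every $A$ and every measurable $c:D\to(0,\infty)$ with $c(x)\le A(1-x^2)^{-\alpha}$ for all $x\in D$, $$C_{\mathsf{exp}}\le C_\alpha A\, n^{\max\{1,2\alpha\}}\log(3n/\epsilon)\quad(\alpha\ne\tfrac12),\qquad C_{\mathsf{exp}}\le C_\alpha A\, n\,\log(3n)\,\log(3n/\epsilon)\quad(\alpha=\tfrac12).$$ 2. (Accuracy.) For every $f\in L^2_\varrho(D)$, the following holds with probability at least $1-\epsilon$ over $x_1,\dots,x_m\sim_{\mathrm{i.i.d.}}\mu$: for every $e\in\mathbb C^m$ the weighted least-squares estimator $\hat f$ exists, is unique and satisfies $$\|f-\hat f\|_{L^2_\varrho(D)}\le K\frac{n}{\sqrt\epsilon}\big(\|f-f_n\|_{L^2_\varrho(D)}+\|e\|_2\big),$$ $$\|f-\hat f\|_{L^\infty_\varrho(D)}\le K\Big(\|f-f_n\|_{L^\infty_\varrho(D)}+\frac{n}{\sqrt\epsilon}\big(\|f-f_n\|_{L^2_\varrho(D)}+\|e\|_2\big)\Big).$$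 -/

import Mathlib

open MeasureTheory Set
open scoped ENNReal Polynomial

noncomputable section

/-- The uniform probability measure on `D = (-1, 1)`. -/
def uniformMeasure : Measure ℝ := (2⁻¹ : ℝ≥0∞) • volume.restrict (Ioo (-1 : ℝ) 1)

/-- The space of complex algebraic polynomials of degree less than `n`. -/
def polySpace (n : ℕ) : Submodule ℂ ℂ[X] := Polynomial.degreeLT ℂ n

/-- The function on the real line given by a complex polynomial. -/
def polyFun (p : ℂ[X]) (x : ℝ) : ℂ := p.eval (x : ℂ)

/-- The shrinkage parameter `σ(n) = (2^{1/n} - 1)^2 / 16`. -/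
def shrink (n : ℕ) : ℝ := ((2 : ℝ) ^ (1 / (n : ℝ)) - 1) ^ 2 / 16

/-- The Chebyshev (arcsine) probability measure rescaled to `(-1 + σ, 1 - σ)`. -/
def chebyshevMeasure (σ : ℝ) : Measure ℝ :=
  volume.withDensity ((Ioo (-1 + σ) (1 - σ)).indicator fun x =>
    ENNReal.ofReal (((1 - σ) * Real.pi)⁻¹ * (1 - (x / (1 - σ)) ^ 2) ^ (-(1 / 2) : ℝ)))

/-- The joint law of `m` independent samples from `μ`. -/
def sampleLaw (μ : Measure ℝ) (m : ℕ) : Measure (Fin m → ℝ) := Measure.pi fun _ => μ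

/-- The expected total cost `E (c x₁ + ⋯ + c xₘ)` of evaluating at `m` independent samples
from `μ`; it is `∞` if `c ≥ 0` is not integrable. -/
def expectedCost (c : ℝ → ℝ) (μ : Measure ℝ) (m : ℕ) : ℝ≥0∞ :=
  ∫⁻ x, ∑ i, ENNReal.ofReal (c (x i)) ∂(sampleLaw μ m)

theorem expectedCost_eq (c : ℝ → ℝ) (hc : Measurable c) (μ : Measure ℝ)
    [IsProbabilityMeasure μ] (m : ℕ) :
    expectedCost c μ m = m * ∫⁻ x, ENNReal.ofReal (c x) ∂μ := by
  unfold expectedCost sampleLaw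
  rw [lintegral_finsetSum _ (fun i _ => by fun_prop)]
  have h : ∀ i : Fin m, ∫⁻ x, ENNReal.ofReal (c (x i)) ∂(Measure.pi fun _ : Fin m => μ)
      = ∫⁻ x, ENNReal.ofReal (c x) ∂μ := fun i =>
    (measurePreserving_eval (fun _ : Fin m => μ) i).lintegral_comp
      (f := fun x => ENNReal.ofReal (c x)) (by fun_prop)
  simp [h]

/-- The weight function `w = 1 / v`, where `v = dμ/dϱ`, with values in `[0, ∞]`. -/
def weightFn (μ ϱ : Measure ℝ) (x : ℝ) : ℝ≥0∞ := (μ.rnDeriv ϱ x)⁻¹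

/-- The weighted least-squares objective `(1/m) ∑ᵢ w(xᵢ) |yᵢ - p(xᵢ)|²`. -/
def lsObjective (w : ℝ → ℝ≥0∞) {m : ℕ} (x : Fin m → ℝ) (y : Fin m → ℂ) (p : ℂ[X]) : ℝ≥0∞ :=
  (m : ℝ≥0∞)⁻¹ * ∑ i, w (x i) * ‖y i - polyFun p (x i)‖ₑ ^ 2

/-- `p` is a weighted least-squares estimator in `P` for the data `(xᵢ, yᵢ)`. -/
def IsLeastSquaresFit (P : Submodule ℂ ℂ[X]) (w : ℝ → ℝ≥0∞) {m : ℕ}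
    (x : Fin m → ℝ) (y : Fin m → ℂ) (p : ℂ[X]) : Prop :=
  p ∈ P ∧ ∀ q ∈ P, lsObjective w x y p ≤ lsObjective w x y q

/-- The `L^q_ϱ` norm of the difference of `f` and a polynomial. -/
def errNorm (ϱ : Measure ℝ) (q : ℝ≥0∞) (f : ℝ → ℂ) (p : ℂ[X]) : ℝ≥0∞ :=
  eLpNorm (fun x => f x - polyFun p x) q ϱ

/-- `p` is the best `L²_ϱ` approximation of `f` in `P`. -/
def IsBestL2Approx (P : Submodule ℂ ℂ[X]) (ϱ : Measure ℝ) (f : ℝ → ℂ) (p : ℂ[X]) : Prop :=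
  p ∈ P ∧ ∀ q ∈ P, errNorm ϱ 2 f p ≤ errNorm ϱ 2 f q

end

/-! Accuracy reduces to a deterministic stability statement. In the angle variable `x = (1 - σ) cos
θ` the measure `μ` is uniform on `(0, π)`. If `(0, π)` is cut into `48 n` equal arcs and each arc
receives at least half of its expected share of the samples, then the weighted discrete norm
dominates the `L²` norm on polynomials of degree `< n` (`integral_norm_sq_le_discrete`). This is a
Marcinkiewicz-Zygmund argument: on an arc, `p(cos θ)² sin θ` differs from its value at a sample by
at most the integral of its derivative. The total of these errors is at most the arc length times `6
n ‖p‖²` (`exists_deriv_bound`), which is absorbed because the arcs are short compared with `1 / n`.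
The derivative is controlled by two Legendre facts: the energy bound `energy_le` and the endpoint
bound `eval_one_sq_le`.

The samples live on an interval shortened by `σ`, which is of order `1 / n²`. Since `|p|² ≤ n² ‖p‖²`
pointwise, the two missing strips carry only a small fraction of the norm.

A Chernoff bound and a union bound over the arcs make all arcs well filled once `m` is of order `n
log(n / ε)`. Markov's inequality bounds the discrete residual `f - f_n` by `2 / ε` times its squared
`L²` norm. On the intersection of these two events, minimality of the estimator and stability bound
`f_n - f̂`; the pointwise bound turns this into an `L^∞` bound at the price of a factor `n`.

For the cost, `1 - x²` is at least a constant times `(dist(θ, {0, π}) + 1/n)²` because `σ` is of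
order at least `1 / n²`. The mean cost is then bounded by `∫ t^(-2α)` over `[1/n, π + 1/n]`, whose
growth in `n` changes at `α = 1/2`. -/

/-! ### Legendre polynomials: endpoint values and energy. -/

/-- Integration of real polynomials over `[-1, 1]`, as a linear functional. -/
noncomputable def polyIntegral : ℝ[X] →ₗ[ℝ] ℝ where
  toFun p := ∫ x in (-1 : ℝ)..1, p.eval x
  map_add' p q := by
    simp only [Polynomial.eval_add]
    exact intervalIntegral.integral_add (p.continuous.intervalIntegrable _ _)
      (q.continuous.intervalIntegrable _ _)
  map_smul' c p := by simp

theorem polyIntegral_apply (p : ℝ[X]) : polyIntegral p = ∫ x in (-1 : ℝ)..1, p.eval x := rfl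

theorem polyIntegral_derivative (p : ℝ[X]) :
    polyIntegral (Polynomial.derivative p) = p.eval 1 - p.eval (-1) :=
  intervalIntegral.integral_eq_sub_of_hasDerivAt (fun x _ => p.hasDerivAt x)
    ((Polynomial.derivative p).continuous.intervalIntegrable _ _)

theorem polyIntegral_mul_self_nonneg (p : ℝ[X]) : 0 ≤ polyIntegral (p * p) := by
  rw [polyIntegral_apply]
  refine intervalIntegral.integral_nonneg (by norm_num) fun x _ => ?_
  rw [Polynomial.eval_mul]
  exact mul_self_nonneg _

theorem eq_zero_of_polyIntegral_mul_self {p : ℝ[X]} (h : polyIntegral (p * p) = 0) : p = 0 := by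
  by_contra hp
  obtain ⟨x, hx, hx0⟩ : ∃ x ∈ Icc (-1 : ℝ) 1, p.eval x ≠ 0 := by
    by_contra! hall
    exact hp (Polynomial.eq_zero_of_infinite_isRoot p
      ((Icc_infinite (by norm_num : (-1 : ℝ) < 1)).mono fun x hx => hall x hx))
  have hpos : 0 < ∫ y in (-1 : ℝ)..1, (p * p).eval y :=
    intervalIntegral.integral_pos (by norm_num) (p * p).continuous.continuousOn
      (fun y _ => by rw [Polynomial.eval_mul]; exact mul_self_nonneg _)
      ⟨x, hx, by rw [Polynomial.eval_mul]; exact mul_self_pos.2 hx0⟩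
  exact hpos.ne' h

/-- There is a monic polynomial of degree `n` orthogonal to all polynomials of smaller degree. -/
theorem exists_monic_orthogonal (n : ℕ) : ∃ e : ℝ[X], e.coeff n = 1 ∧ (∀ m, n < m → e.coeff m = 0) ∧
    ∀ q ∈ Polynomial.degreeLT ℝ n, polyIntegral (q * e) = 0 := by
  let V := Polynomial.degreeLT ℝ n
  have : Module.Finite ℝ V := Module.Finite.equiv (Polynomial.degreeLTEquiv ℝ n).symm
  let B : ℝ[X] →ₗ[ℝ] ℝ[X] →ₗ[ℝ] ℝ := (LinearMap.mul ℝ ℝ[X]).compr₂ polyIntegral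
  let φ : V →ₗ[ℝ] Module.Dual ℝ V := (B.domRestrict₁₂ V V)
  have hφ : Function.Injective φ := by
    rw [injective_iff_map_eq_zero]
    intro q hq
    have := LinearMap.congr_fun hq q
    exact Subtype.ext (eq_zero_of_polyIntegral_mul_self this)
  have hs : Function.Surjective φ :=
    (LinearMap.injective_iff_surjective_of_finrank_eq_finrank Subspace.dual_finrank_eq.symm).1 hφ
  -- The form `B` is positive definite on the finite-dimensional space `V`, so `q` is the orthogonal
  -- projection of `X ^ n` onto `V`, and `X ^ n - q` is the polynomial sought.
  obtain ⟨q, hq⟩ := hs ((B (Polynomial.X ^ n)).domRestrict V)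
  have hqc : ∀ m, n ≤ m → (q : ℝ[X]).coeff m = 0 :=
    fun m hm => Polynomial.coeff_eq_zero_of_degree_lt
      ((Polynomial.mem_degreeLT.1 q.2).trans_le (by exact_mod_cast hm))
  refine ⟨Polynomial.X ^ n - (q : ℝ[X]), ?_, ?_, ?_⟩
  · simp [hqc n le_rfl]
  · intro m hm
    simp [hqc m hm.le, Polynomial.coeff_X_pow, hm.ne']
  · intro r hr
    have h1 : polyIntegral ((q : ℝ[X]) * r) = polyIntegral (Polynomial.X ^ n * r) :=
      LinearMap.congr_fun hq ⟨r, hr⟩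
    rw [mul_sub, map_sub, mul_comm r, mul_comm r, h1, sub_self]

theorem mem_degreeLT_of_coeff {R : Type*} [CommRing R] {n : ℕ} {p : R[X]}
    (h : ∀ m, n ≤ m → p.coeff m = 0) : p ∈ Polynomial.degreeLT R n :=
  Polynomial.mem_degreeLT.2 ((Polynomial.degree_lt_iff_coeff_zero p n).2 fun m hm => h m hm)

theorem coeff_of_mem_degreeLT {R : Type*} [CommRing R] {n : ℕ} {p : R[X]}
    (h : p ∈ Polynomial.degreeLT R n) (m : ℕ) (hm : n ≤ m) : p.coeff m = 0 :=
  (Polynomial.degree_lt_iff_coeff_zero p n).1 (Polynomial.mem_degreeLT.1 h) m hm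

theorem coeff_X_mul_derivative_eq (p : ℝ[X]) (m : ℕ) :
    (Polynomial.X * Polynomial.derivative p).coeff m = m * p.coeff m := by
  cases m with
  | zero => simp
  | succ k => rw [Polynomial.coeff_X_mul, Polynomial.coeff_derivative]; push_cast; ring

theorem coeff_legendre_operator (p : ℝ[X]) (m : ℕ) :
    (Polynomial.derivative ((1 - Polynomial.X ^ 2) * Polynomial.derivative p)).coeff m
      = (m + 2) * (m + 1) * p.coeff (m + 2) - m * (m + 1) * p.coeff m := by
  have h : (1 - Polynomial.X ^ 2) * Polynomial.derivative p
      = Polynomial.derivative p - Polynomial.X * (Polynomial.X * Polynomial.derivative p) := by ring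
  rw [h, Polynomial.coeff_derivative, Polynomial.coeff_sub, Polynomial.coeff_derivative,
    Polynomial.coeff_X_mul, coeff_X_mul_derivative_eq]
  push_cast
  ring

/-- Integrate `(x e²)' = 2 (x e' - n e) e + (2n + 1) e²`. In `x e' - n e` the terms of degree `n`
cancel, so orthogonality removes the first summand. -/
theorem orthogonal_eval_sq {n : ℕ} {e : ℝ[X]}
    (h0 : ∀ m, n < m → e.coeff m = 0)
    (ho : ∀ q ∈ Polynomial.degreeLT ℝ n, polyIntegral (q * e) = 0) :
    e.eval 1 ^ 2 + e.eval (-1) ^ 2 = (2 * n + 1) * polyIntegral (e * e) := by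
  have hr : Polynomial.X * Polynomial.derivative e - (n : ℝ) • e ∈ Polynomial.degreeLT ℝ n := by
    refine mem_degreeLT_of_coeff fun m hm => ?_
    rw [Polynomial.coeff_sub, coeff_X_mul_derivative_eq, Polynomial.coeff_smul, smul_eq_mul]
    rcases hm.eq_or_lt with rfl | hm
    · ring
    · simp [h0 m hm]
  have h2 := ho _ hr
  have h3 := polyIntegral_derivative (Polynomial.X * (e * e))
  have h4 : Polynomial.derivative (Polynomial.X * (e * e))
      = (2 : ℝ) • ((Polynomial.X * Polynomial.derivative e - (n : ℝ) • e) * e)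
        + (2 * n + 1 : ℝ) • (e * e) := by
    simp only [Polynomial.derivative_mul, Polynomial.derivative_X, Polynomial.smul_eq_C_mul]
    simp only [map_add, map_mul, map_one, map_ofNat]
    ring
  rw [h4, map_add, map_smul, map_smul, h2] at h3
  simp only [Polynomial.eval_mul, Polynomial.eval_X, smul_eq_mul] at h3
  linarith

/-- Integration by parts; the boundary terms vanish because `1 - x²` does at `±1`. -/
theorem polyIntegral_parts (p q : ℝ[X]) :
    polyIntegral ((1 - Polynomial.X ^ 2) * Polynomial.derivative p * Polynomial.derivative q)
      = - polyIntegral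
        (Polynomial.derivative ((1 - Polynomial.X ^ 2) * Polynomial.derivative p) * q) := by
  have h := polyIntegral_derivative ((1 - Polynomial.X ^ 2) * Polynomial.derivative p * q)
  rw [Polynomial.derivative_mul, map_add] at h
  simp only [Polynomial.eval_mul, Polynomial.eval_sub, Polynomial.eval_one, Polynomial.eval_pow,
    Polynomial.eval_X] at h
  linarith

theorem legendre_operator_mem {n : ℕ} {q : ℝ[X]} (hq : q ∈ Polynomial.degreeLT ℝ n) :
    Polynomial.derivative ((1 - Polynomial.X ^ 2) * Polynomial.derivative q)
      ∈ Polynomial.degreeLT ℝ n := by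
  refine mem_degreeLT_of_coeff fun m hm => ?_
  rw [coeff_legendre_operator, coeff_of_mem_degreeLT hq m hm,
    coeff_of_mem_degreeLT hq (m + 2) (by omega)]
  ring

/-- The Legendre operator acts on the top coefficient as multiplication by `-n(n + 1)`. Hence `((1 -
x²) e')' + n(n + 1) e` has degree `< n` and is orthogonal to `e`. -/
theorem orthogonal_energy {n : ℕ} {e : ℝ[X]}
    (h0 : ∀ m, n < m → e.coeff m = 0)
    (ho : ∀ q ∈ Polynomial.degreeLT ℝ n, polyIntegral (q * e) = 0) :
    polyIntegral ((1 - Polynomial.X ^ 2) * Polynomial.derivative e * Polynomial.derivative e)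
      = n * (n + 1) * polyIntegral (e * e) := by
  have hr : Polynomial.derivative ((1 - Polynomial.X ^ 2) * Polynomial.derivative e)
      + (n * (n + 1) : ℝ) • e ∈ Polynomial.degreeLT ℝ n := by
    refine mem_degreeLT_of_coeff fun m hm => ?_
    rw [Polynomial.coeff_add, coeff_legendre_operator, Polynomial.coeff_smul, smul_eq_mul,
      h0 (m + 2) (by omega)]
    rcases hm.eq_or_lt with rfl | hm
    · ring
    · simp [h0 m hm]
  have h2 := ho _ hr
  rw [add_mul, map_add, smul_mul_assoc, map_smul, smul_eq_mul] at h2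
  rw [polyIntegral_parts]
  linarith

/-- Splitting off the top orthogonal component of a polynomial. -/
theorem exists_orthogonal_split {n : ℕ} {p : ℝ[X]} (hp : p ∈ Polynomial.degreeLT ℝ (n + 1)) :
    ∃ (q e : ℝ[X]) (c : ℝ), p = q + c • e ∧ q ∈ Polynomial.degreeLT ℝ n ∧ e.coeff n = 1 ∧
      (∀ m, n < m → e.coeff m = 0) ∧
      ∀ q ∈ Polynomial.degreeLT ℝ n, polyIntegral (q * e) = 0 := by
  obtain ⟨e, h1, h0, ho⟩ := exists_monic_orthogonal n
  refine ⟨p - p.coeff n • e, e, p.coeff n, by ring, ?_, h1, h0, ho⟩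
  refine mem_degreeLT_of_coeff fun m hm => ?_
  rw [Polynomial.coeff_sub, Polynomial.coeff_smul, smul_eq_mul]
  rcases hm.eq_or_lt with rfl | hm
  · rw [h1]; ring
  · rw [h0 m hm, coeff_of_mem_degreeLT hp m hm]; ring

theorem polyIntegral_split {n : ℕ} {q e : ℝ[X]} (c : ℝ) (hq : q ∈ Polynomial.degreeLT ℝ n)
    (ho : ∀ q ∈ Polynomial.degreeLT ℝ n, polyIntegral (q * e) = 0) :
    polyIntegral ((q + c • e) * (q + c • e))
      = polyIntegral (q * q) + c ^ 2 * polyIntegral (e * e) := by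
  have h : (q + c • e) * (q + c • e) = q * q + (2 * c) • (q * e) + (c ^ 2) • (e * e) := by
    simp only [Polynomial.smul_eq_C_mul, map_mul, map_pow, map_ofNat]; ring
  rw [h, map_add, map_add, map_smul, map_smul, ho q hq]
  simp

/-- Induction on the degree, adding one orthogonal component at a time: the contributions `2k + 1`
for `k < n` sum to `n²`. -/
theorem eval_one_sq_le (n : ℕ) : ∀ p ∈ Polynomial.degreeLT ℝ n,
    p.eval 1 ^ 2 ≤ (n : ℝ) ^ 2 * polyIntegral (p * p) := by
  induction n with
  | zero =>
    intro p hp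
    have : p = 0 := by
      ext m; simpa using coeff_of_mem_degreeLT hp m (Nat.zero_le m)
    simp [this]
  | succ n ih =>
    intro p hp
    obtain ⟨q, e, c, rfl, hq, h1, h0, ho⟩ := exists_orthogonal_split hp
    have hA := ih q hq
    have hB := orthogonal_eval_sq h0 ho
    rw [polyIntegral_split c hq ho, Polynomial.eval_add, Polynomial.eval_smul, smul_eq_mul]
    have hu := polyIntegral_mul_self_nonneg q
    have hv := polyIntegral_mul_self_nonneg e
    set u := polyIntegral (q * q)
    set v := polyIntegral (e * e)
    -- Discarding the value at `-1` costs a factor 2, which parity of the Legendre polynomials would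
    -- save.
    have hE : e.eval 1 ^ 2 ≤ (2 * n + 1) * v := by nlinarith [sq_nonneg (e.eval (-1))]
    set a := q.eval 1
    set b := e.eval 1
    have hb : (c * b) ^ 2 ≤ (2 * n + 1) * (c ^ 2 * v) := by
      nlinarith [mul_le_mul_of_nonneg_left hE (sq_nonneg c)]
    have hw : 0 ≤ c ^ 2 * v := by positivity
    set w := c ^ 2 * v
    set d := c * b
    push_cast
    -- The cross term of the Cauchy-Schwarz inequality `(a + d)² ≤ (n² + (2n + 1)) (u + w)`.
    have hab : 2 * a * d ≤ n ^ 2 * w + (2 * n + 1) * u := by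
      have h : (2 * a * d) ^ 2 ≤ (n ^ 2 * w + (2 * n + 1) * u) ^ 2 := by
        have : a ^ 2 * d ^ 2 ≤ (n ^ 2 * u) * ((2 * n + 1) * w) :=
          mul_le_mul hA hb (sq_nonneg _) (by positivity)
        nlinarith [sq_nonneg ((n : ℝ) ^ 2 * w - (2 * n + 1) * u)]
      exact le_of_sq_le_sq h (by positivity)
    nlinarith

/-- The orthogonal splitting diagonalizes the energy as well, since the Legendre operator preserves
degree. Each component has eigenvalue `k(k + 1) ≤ n²` for `k < n`. -/
theorem energy_le (n : ℕ) : ∀ p ∈ Polynomial.degreeLT ℝ n,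
    polyIntegral ((1 - Polynomial.X ^ 2) * Polynomial.derivative p * Polynomial.derivative p)
      ≤ (n : ℝ) ^ 2 * polyIntegral (p * p) := by
  induction n with
  | zero =>
    intro p hp
    have : p = 0 := by
      ext m; simpa using coeff_of_mem_degreeLT hp m (Nat.zero_le m)
    simp [this]
  | succ n ih =>
    intro p hp
    obtain ⟨q, e, c, rfl, hq, h1, h0, ho⟩ := exists_orthogonal_split hp
    have hA := ih q hq
    have hB := orthogonal_energy h0 ho
    have hC : polyIntegral
        ((1 - Polynomial.X ^ 2) * Polynomial.derivative q * Polynomial.derivative e) = 0 := by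
      rw [polyIntegral_parts, ho _ (legendre_operator_mem hq), neg_zero]
    have h : (1 - Polynomial.X ^ 2) * Polynomial.derivative (q + c • e)
          * Polynomial.derivative (q + c • e)
        = (1 - Polynomial.X ^ 2) * Polynomial.derivative q * Polynomial.derivative q
        + (2 * c) • ((1 - Polynomial.X ^ 2) * Polynomial.derivative q * Polynomial.derivative e)
        + (c ^ 2) •
          ((1 - Polynomial.X ^ 2) * Polynomial.derivative e * Polynomial.derivative e) := by
      rw [Polynomial.derivative_add, Polynomial.derivative_smul]
      simp only [Polynomial.smul_eq_C_mul, map_mul, map_pow, map_ofNat]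
      ring
    rw [polyIntegral_split c hq ho, h, map_add, map_add, map_smul, map_smul, hC, hB]
    have hu := polyIntegral_mul_self_nonneg q
    have hw : 0 ≤ c ^ 2 * polyIntegral (e * e) :=
      mul_nonneg (sq_nonneg c) (polyIntegral_mul_self_nonneg e)
    simp only [smul_eq_mul, mul_zero, add_zero]
    push_cast
    have hn : (0 : ℝ) ≤ n := n.cast_nonneg
    nlinarith [mul_nonneg hn hw, mul_nonneg hn hu]

/-! ### Pointwise bound on the whole interval. -/

theorem comp_affine_mem {R : Type*} [CommRing R] {n : ℕ} {p : R[X]}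
    (hp : p ∈ Polynomial.degreeLT R n) (a b : R) :
    p.comp (Polynomial.C a + Polynomial.C b * Polynomial.X) ∈ Polynomial.degreeLT R n := by
  rcases n.eq_zero_or_pos with rfl | hn
  · have : p = 0 := by
      ext m; simpa using coeff_of_mem_degreeLT hp m (Nat.zero_le m)
    simp [this]
  · have h1 : p.natDegree < n := by
      by_contra! h
      have h0 := coeff_of_mem_degreeLT hp _ h
      rw [Polynomial.coeff_natDegree, Polynomial.leadingCoeff_eq_zero] at h0
      simp [h0] at h
      omega
    refine mem_degreeLT_of_coeff fun m hm =>
      Polynomial.coeff_eq_zero_of_natDegree_lt (lt_of_lt_of_le ?_ hm)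
    have h2 : (Polynomial.C a + Polynomial.C b * Polynomial.X).natDegree ≤ 1 := by
      compute_degree
    calc _ ≤ _ := Polynomial.natDegree_comp_le
      _ ≤ p.natDegree * 1 := Nat.mul_le_mul_left _ h2
      _ < n := by omega

/-- The pointwise bound for polynomials of degree `< n` in terms of the `L²(-1, 1)` norm. -/
theorem eval_sq_le {n : ℕ} {p : ℝ[X]} (hp : p ∈ Polynomial.degreeLT ℝ n) {x : ℝ}
    (hx : x ∈ Icc (-1 : ℝ) 1) :
    p.eval x ^ 2 ≤ (n : ℝ) ^ 2 * ∫ y in (-1 : ℝ)..1, p.eval y ^ 2 := by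
  -- The endpoint bound is transported to the interval between `a - b` and `a + b`. Allowing `b ≤ 0`
  -- covers both `[-1, x]` and `[x, 1]` with `x` as the distinguished endpoint; the two resulting
  -- bounds have weights `(x + 1)/2` and `(1 - x)/2`, which sum to 1.
  have key : ∀ a b : ℝ, p.eval (a + b) ^ 2 * b ^ 2 ≤
      (n : ℝ) ^ 2 * (b * ∫ y in (a - b)..(a + b), p.eval y ^ 2) := by
    intro a b
    have h := eval_one_sq_le n _ (comp_affine_mem hp a b)
    have h2 := intervalIntegral.mul_integral_comp_add_mul (a := -1) (b := 1)
      (f := fun y => p.eval y ^ 2) b a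
    simp only [polyIntegral_apply, Polynomial.eval_mul, Polynomial.eval_comp, Polynomial.eval_add,
      Polynomial.eval_C, Polynomial.eval_X, mul_one] at h
    simp only [← sq] at h
    rw [mul_one, mul_neg_one, ← sub_eq_add_neg] at h2
    rw [← h2]
    nlinarith [mul_le_mul_of_nonneg_right h (sq_nonneg b)]
  have hii : ∀ a b : ℝ, IntervalIntegrable (fun y => p.eval y ^ 2) volume a b := fun a b =>
    (p.continuous.pow 2).intervalIntegrable _ _
  have h1 := key ((x - 1) / 2) ((x + 1) / 2)
  have h2 := key ((x + 1) / 2) ((x - 1) / 2)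
  rw [show (x - 1) / 2 + (x + 1) / 2 = x by ring,
    show (x - 1) / 2 - (x + 1) / 2 = -1 by ring] at h1
  rw [show (x + 1) / 2 + (x - 1) / 2 = x by ring,
    show (x + 1) / 2 - (x - 1) / 2 = 1 by ring, intervalIntegral.integral_symm] at h2
  rw [← intervalIntegral.integral_add_adjacent_intervals (hii (-1) x) (hii x 1)]
  have hA : 0 ≤ ∫ y in (-1 : ℝ)..x, p.eval y ^ 2 :=
    intervalIntegral.integral_nonneg hx.1 fun _ _ => sq_nonneg _
  have hB : 0 ≤ ∫ y in x..1, p.eval y ^ 2 :=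
    intervalIntegral.integral_nonneg hx.2 fun _ _ => sq_nonneg _
  have hL : p.eval x ^ 2 * ((x + 1) / 2) ≤ (n : ℝ) ^ 2 * ∫ y in (-1 : ℝ)..x, p.eval y ^ 2 := by
    rcases hx.1.eq_or_lt with h | h
    · rw [← h]; simp
    · refine le_of_mul_le_mul_right ?_ (show 0 < (x + 1) / 2 by linarith)
      nlinarith
  have hR : p.eval x ^ 2 * ((1 - x) / 2) ≤ (n : ℝ) ^ 2 * ∫ y in x..1, p.eval y ^ 2 := by
    rcases hx.2.eq_or_lt with h | h
    · rw [h]; simp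
    · refine le_of_mul_le_mul_right ?_ (show 0 < (1 - x) / 2 by linarith)
      nlinarith
  nlinarith

/-! ### The angle variable and the derivative of `p(cos θ)² sin θ`. -/

theorem integral_cos_mul_sin {f : ℝ → ℝ} (hf : Continuous f) :
    ∫ θ in (0 : ℝ)..Real.pi, f (Real.cos θ) * Real.sin θ = ∫ x in (-1 : ℝ)..1, f x := by
  have h := intervalIntegral.integral_comp_mul_deriv' (a := 0) (b := Real.pi) (f := Real.cos)
    (f' := fun θ => -Real.sin θ) (g := f) (fun x _ => Real.hasDerivAt_cos x)
    (by fun_prop) hf.continuousOn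
  rw [Real.cos_zero, Real.cos_pi, intervalIntegral.integral_symm (-1) 1] at h
  simp only [Function.comp_apply, mul_neg, intervalIntegral.integral_neg] at h
  linarith

/-- Comparison of an integral with a point value, given a bound on the derivative. -/
theorem integral_le_eval_add {g g' h : ℝ → ℝ} {a b ξ : ℝ} (hξ : ξ ∈ Icc a b)
    (hg : ∀ t, HasDerivAt g (g' t) t) (hg' : Continuous g') (hh : Continuous h)
    (hle : ∀ t ∈ Icc a b, |g' t| ≤ h t) :
    ∫ t in a..b, g t ≤ (b - a) * (g ξ + ∫ t in a..b, h t) := by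
  have hab : a ≤ b := hξ.1.trans hξ.2
  have hgc : Continuous g := continuous_iff_continuousAt.2 fun t => (hg t).continuousAt
  have hsub : ∀ s t, s ∈ Icc a b → t ∈ Icc a b → s ≤ t →
      |∫ r in s..t, g' r| ≤ ∫ r in a..b, h r := by
    intro s t hs ht hst
    calc |∫ r in s..t, g' r| ≤ ∫ r in s..t, |g' r| := intervalIntegral.abs_integral_le_integral_abs hst
      _ ≤ ∫ r in s..t, h r := intervalIntegral.integral_mono_on hst
          (hg'.abs.intervalIntegrable _ _) (hh.intervalIntegrable _ _)
          fun r hr => hle r ⟨hs.1.trans hr.1, hr.2.trans ht.2⟩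
      _ ≤ ∫ r in a..b, h r := by
          refine intervalIntegral.integral_mono_interval hs.1 hst ht.2 ?_
            (hh.intervalIntegrable _ _)
          refine (ae_restrict_iff' measurableSet_Ioc).2 (ae_of_all _ fun r hr => ?_)
          exact (abs_nonneg _).trans (hle r (Ioc_subset_Icc_self hr))
  have hpt : ∀ t ∈ Icc a b, g t ≤ g ξ + ∫ r in a..b, h r := by
    intro t ht
    rcases le_total ξ t with hc | hc
    · have h1 := intervalIntegral.integral_eq_sub_of_hasDerivAt (fun x _ => hg x)
        (hg'.intervalIntegrable ξ t)
      have h2 := (abs_le.1 (hsub ξ t hξ ht hc)).2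
      linarith
    · have h1 := intervalIntegral.integral_eq_sub_of_hasDerivAt (fun x _ => hg x)
        (hg'.intervalIntegrable t ξ)
      have h2 := (abs_le.1 (hsub t ξ ht hξ hc)).1
      linarith
  calc ∫ t in a..b, g t ≤ ∫ _ in a..b, (g ξ + ∫ r in a..b, h r) :=
        intervalIntegral.integral_mono_on hab (hgc.intervalIntegrable _ _)
          (continuous_const.intervalIntegrable _ _) hpt
    _ = _ := by rw [intervalIntegral.integral_const, smul_eq_mul]

theorem inv_le_sin {n : ℕ} (hn : 1 ≤ n) {θ : ℝ} (h1 : 1 / (n : ℝ) ≤ θ)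
    (h2 : θ ≤ Real.pi - 1 / n) : 1 ≤ 2 * n * Real.sin θ := by
  have hn' : (0 : ℝ) < n := by exact_mod_cast hn
  have hpi := Real.pi_pos
  have key : ∀ t : ℝ, 1 / (n : ℝ) ≤ t → t ≤ Real.pi / 2 → 1 ≤ 2 * n * Real.sin t := by
    intro t ht ht2
    have ht0 : 0 ≤ t := le_trans (by positivity) ht
    have hs := Real.mul_le_sin ht0 ht2
    have h3 : 1 / 2 * t ≤ 2 / Real.pi * t := by
      refine mul_le_mul_of_nonneg_right ?_ ht0
      rw [div_le_div_iff₀ (by norm_num) hpi]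
      linarith [Real.pi_le_four]
    have h4 : 1 ≤ n * t := by
      rw [div_le_iff₀ hn'] at ht; linarith
    nlinarith
  rcases le_total θ (Real.pi / 2) with h | h
  · exact key θ h1 h
  · have := key (Real.pi - θ) (by linarith) (by linarith)
    rwa [Real.sin_pi_sub] at this

/-- The `L²` norm with respect to the arcsine weight against the unweighted norm. -/
theorem integral_comp_cos_sq_le {n : ℕ} (hn : 1 ≤ n) {p : ℝ[X]}
    (hp : p ∈ Polynomial.degreeLT ℝ n) :
    ∫ θ in (0 : ℝ)..Real.pi, p.eval (Real.cos θ) ^ 2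
      ≤ 4 * n * ∫ x in (-1 : ℝ)..1, p.eval x ^ 2 := by
  have hn' : (1 : ℝ) ≤ n := by exact_mod_cast hn
  have hn0 : (0 : ℝ) < n := by linarith
  set G := ∫ x in (-1 : ℝ)..1, p.eval x ^ 2 with hG
  set T : ℝ → ℝ := fun θ => p.eval (Real.cos θ) ^ 2 with hT
  have hTc : Continuous T := (p.continuous.comp Real.continuous_cos).pow 2
  have hsin : ∫ θ in (0 : ℝ)..Real.pi, T θ * Real.sin θ = G :=
    integral_cos_mul_sin (f := fun x => p.eval x ^ 2) (p.continuous.pow 2)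
  have hii : ∀ a b, IntervalIntegrable T volume a b := fun a b => hTc.intervalIntegrable _ _
  have hTb : ∀ θ, T θ ≤ (n : ℝ) ^ 2 * G := fun θ =>
    eval_sq_le hp ⟨Real.neg_one_le_cos θ, Real.cos_le_one θ⟩
  have hδ : 1 / (n : ℝ) ≤ 1 := by rw [div_le_one hn0]; exact hn'
  have hδ0 : 0 < 1 / (n : ℝ) := by positivity
  have hpi := Real.pi_gt_three
  -- Near `0` and `π`, where `sin θ` degenerates, the pointwise bound `n² G` is integrated over
  -- length `1/n`. In the middle `1 ≤ 2 n sin θ` inserts the missing Jacobian. The total is `n + n +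
  -- 2n = 4n`.
  have hends : ∀ a : ℝ, ∫ θ in a..(a + 1 / n), T θ ≤ n * G := by
    intro a
    calc ∫ θ in a..(a + 1 / n), T θ ≤ ∫ θ in a..(a + 1 / n), (n : ℝ) ^ 2 * G :=
          intervalIntegral.integral_mono_on (by linarith) (hii _ _)
            (continuous_const.intervalIntegrable _ _) fun θ _ => hTb θ
      _ = n * G := by
          rw [intervalIntegral.integral_const, smul_eq_mul]; field_simp; ring
  have hmid : ∫ θ in (1 / n : ℝ)..(Real.pi - 1 / n), T θ ≤ 2 * n * G := by
    have hcs : Continuous fun θ => 2 * n * (T θ * Real.sin θ) := by fun_prop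
    have hcs' : Continuous fun θ => T θ * Real.sin θ := by fun_prop
    calc ∫ θ in (1 / n : ℝ)..(Real.pi - 1 / n), T θ
        ≤ ∫ θ in (1 / n : ℝ)..(Real.pi - 1 / n), 2 * n * (T θ * Real.sin θ) := by
          refine intervalIntegral.integral_mono_on (by linarith) (hii _ _)
            (hcs.intervalIntegrable _ _) fun θ hθ => ?_
          have := inv_le_sin hn hθ.1 hθ.2
          nlinarith [show 0 ≤ T θ from sq_nonneg _]
      _ = 2 * n * ∫ θ in (1 / n : ℝ)..(Real.pi - 1 / n), T θ * Real.sin θ := by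
          rw [intervalIntegral.integral_const_mul]
      _ ≤ 2 * n * G := by
          refine mul_le_mul_of_nonneg_left ?_ (by positivity)
          rw [← hsin]
          refine intervalIntegral.integral_mono_interval hδ0.le (by linarith) (by linarith) ?_
            (hcs'.intervalIntegrable _ _)
          refine (ae_restrict_iff' measurableSet_Ioc).2 (ae_of_all _ fun θ hθ => ?_)
          exact mul_nonneg (sq_nonneg _) (Real.sin_nonneg_of_nonneg_of_le_pi hθ.1.le hθ.2)
  have e1 := hends 0
  have e2 := hends (Real.pi - 1 / n)
  rw [zero_add] at e1
  rw [sub_add_cancel] at e2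
  rw [← intervalIntegral.integral_add_adjacent_intervals (hii 0 (1 / n)) (hii (1 / n) Real.pi),
    ← intervalIntegral.integral_add_adjacent_intervals (hii (1 / n) (Real.pi - 1 / n))
      (hii (Real.pi - 1 / n) Real.pi)]
  linarith

theorem integral_eval_sq_eq (p : ℝ[X]) :
    polyIntegral (p * p) = ∫ x in (-1 : ℝ)..1, p.eval x ^ 2 := by
  simp [polyIntegral_apply, sq]

/-- A dominating function for the derivative of `p(cos θ)² sin θ` with controlled integral. -/
theorem exists_deriv_bound {n : ℕ} (hn : 1 ≤ n) {p : ℝ[X]} (hp : p ∈ Polynomial.degreeLT ℝ n) :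
    ∃ g' h : ℝ → ℝ, Continuous g' ∧ Continuous h ∧
      (∀ t, HasDerivAt (fun θ => p.eval (Real.cos θ) ^ 2 * Real.sin θ) (g' t) t) ∧
      (∀ t ∈ Icc 0 Real.pi, |g' t| ≤ h t) ∧
      ∫ t in (0 : ℝ)..Real.pi, h t ≤ 6 * n * ∫ x in (-1 : ℝ)..1, p.eval x ^ 2 := by
  have hn' : (1 : ℝ) ≤ n := by exact_mod_cast hn
  have hn0 : (0 : ℝ) < n := by linarith
  set d := Polynomial.derivative p with hd
  have hpc : Continuous fun x : ℝ => p.eval x := p.continuous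
  have hdc : Continuous fun x : ℝ => d.eval x := d.continuous
  let A : ℝ → ℝ := fun t => (1 - Real.cos t ^ 2) * d.eval (Real.cos t) ^ 2 * Real.sin t
  let B : ℝ → ℝ := fun t => p.eval (Real.cos t) ^ 2 * Real.sin t
  let T : ℝ → ℝ := fun t => p.eval (Real.cos t) ^ 2
  have hpc' : Continuous fun t : ℝ => p.eval (Real.cos t) := hpc.comp Real.continuous_cos
  have hdc' : Continuous fun t : ℝ => d.eval (Real.cos t) := hdc.comp Real.continuous_cos
  have hA : Continuous A := by fun_prop
  have hB : Continuous B := by fun_prop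
  have hT : Continuous T := by fun_prop
  -- The weights `1/n` and `n` come from the arithmetic-geometric mean inequality for `2 |p p'
  -- sin|`, balanced so that `A` (energy, at most `n² G`) and `B` (integral `G`) each contribute at
  -- most `n G`. With `4 n G` from `T` the total is `6 n G`.
  refine ⟨fun t => 2 * p.eval (Real.cos t) * (d.eval (Real.cos t) * (-Real.sin t)) * Real.sin t
      + p.eval (Real.cos t) ^ 2 * Real.cos t,
    fun t => (1 / n * A t + n * B t) + T t, by fun_prop, by fun_prop, ?_, ?_, ?_⟩
  · intro t
    have h1 : HasDerivAt (fun θ => p.eval (Real.cos θ)) (d.eval (Real.cos t) * (-Real.sin t)) t :=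
      (p.hasDerivAt (Real.cos t)).comp t (Real.hasDerivAt_cos t)
    have h2 := (h1.fun_pow 2).fun_mul (Real.hasDerivAt_sin t)
    simpa using h2
  · intro t ht
    have hs : 0 ≤ Real.sin t := Real.sin_nonneg_of_nonneg_of_le_pi ht.1 ht.2
    have hc := Real.abs_cos_le_one t
    have hsc : 1 - Real.cos t ^ 2 = Real.sin t ^ 2 := by
      linarith [Real.sin_sq_add_cos_sq t]
    simp only [A, B, T, hsc]
    set P := p.eval (Real.cos t)
    set Q := d.eval (Real.cos t)
    set s := Real.sin t
    have h1 : |2 * P * (Q * -s)| ≤ 1 / n * (s ^ 2 * Q ^ 2) + n * P ^ 2 := by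
      have e : 1 / (n : ℝ) * (s ^ 2 * Q ^ 2) + n * P ^ 2 = n * ((s * Q / n) ^ 2 + P ^ 2) := by
        field_simp
      have e2 : 2 * P * (Q * -s) = n * (-(2 * P * (s * Q / n))) := by field_simp
      rw [e, e2, abs_mul, abs_of_pos hn0]
      refine mul_le_mul_of_nonneg_left ?_ hn0.le
      rw [abs_le]
      constructor <;> nlinarith [sq_nonneg (s * Q / n - P), sq_nonneg (s * Q / n + P)]
    calc |2 * P * (Q * -s) * s + P ^ 2 * Real.cos t|
        ≤ |2 * P * (Q * -s) * s| + |P ^ 2 * Real.cos t| := abs_add_le _ _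
      _ ≤ (1 / n * (s ^ 2 * Q ^ 2) + n * P ^ 2) * s + P ^ 2 * 1 := by
          rw [abs_mul _ s, abs_of_nonneg hs, abs_mul (P ^ 2), abs_of_nonneg (sq_nonneg P)]
          gcongr
      _ = _ := by ring
  · rw [intervalIntegral.integral_add ((by fun_prop : Continuous _).intervalIntegrable _ _)
      (hT.intervalIntegrable _ _),
      intervalIntegral.integral_add ((by fun_prop : Continuous _).intervalIntegrable _ _)
        ((by fun_prop : Continuous _).intervalIntegrable _ _),
      intervalIntegral.integral_const_mul, intervalIntegral.integral_const_mul]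
    have hIA : ∫ t in (0 : ℝ)..Real.pi, A t ≤ n ^ 2 * ∫ x in (-1 : ℝ)..1, p.eval x ^ 2 := by
      have h1 := integral_cos_mul_sin (f := fun x => (1 - x ^ 2) * d.eval x ^ 2) (by fun_prop)
      have h2 := energy_le n p hp
      rw [integral_eval_sq_eq, polyIntegral_apply] at h2
      simp only [Polynomial.eval_mul, Polynomial.eval_sub, Polynomial.eval_one,
        Polynomial.eval_pow, Polynomial.eval_X, mul_assoc, ← sq] at h2
      rw [h1]
      exact h2
    have hIB : ∫ t in (0 : ℝ)..Real.pi, B t = ∫ x in (-1 : ℝ)..1, p.eval x ^ 2 :=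
      integral_cos_mul_sin (f := fun x => p.eval x ^ 2) (by fun_prop)
    have hIT := integral_comp_cos_sq_le hn hp
    rw [hIB]
    have h3 : 1 / (n : ℝ) * ∫ t in (0 : ℝ)..Real.pi, A t
        ≤ n * ∫ x in (-1 : ℝ)..1, p.eval x ^ 2 := by
      rw [div_mul_eq_mul_div, one_mul, div_le_iff₀ hn0]
      linarith
    linarith

/-! ### Marcinkiewicz-Zygmund inequality over arcs. -/

/-- The index of the arc of length `π / N` containing `θ`. -/
noncomputable def arcIndex (N : ℕ) (θ : ℝ) : ℕ := ⌊θ * N / Real.pi⌋₊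

theorem arcIndex_lt {N : ℕ} (hN : 0 < N) {θ : ℝ} (h0 : 0 ≤ θ) (h1 : θ < Real.pi) :
    arcIndex N θ < N := by
  have hN' : (0 : ℝ) < N := by exact_mod_cast hN
  have hpi := Real.pi_pos
  refine (Nat.floor_lt (by positivity)).2 ?_
  rw [div_lt_iff₀ hpi, mul_comm]
  exact mul_lt_mul_of_pos_left h1 hN'

theorem arcIndex_eq_iff {N : ℕ} (hN : 0 < N) {θ : ℝ} (h0 : 0 ≤ θ) (k : ℕ) :
    arcIndex N θ = k ↔ k * (Real.pi / N) ≤ θ ∧ θ < (k + 1) * (Real.pi / N) := by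
  have hN' : (0 : ℝ) < N := by exact_mod_cast hN
  have hpi := Real.pi_pos
  rw [arcIndex, Nat.floor_eq_iff (by positivity), le_div_iff₀ hpi, div_lt_iff₀ hpi,
    ← mul_div_assoc, ← mul_div_assoc, div_le_iff₀ hN', lt_div_iff₀ hN']

/-- A Marcinkiewicz-Zygmund type inequality for points that are spread over all arcs. -/
theorem integral_sq_le_sum {n m : ℕ} (hn : 1 ≤ n) (hm : 0 < m) {p : ℝ[X]}
    (hp : p ∈ Polynomial.degreeLT ℝ n) (θ : Fin m → ℝ) (h0 : ∀ i, 0 ≤ θ i)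
    (h1 : ∀ i, θ i < Real.pi)
    (hcount : ∀ k < 48 * n, (m : ℝ) ≤
      2 * (48 * n : ℕ) * (Finset.univ.filter fun i => arcIndex (48 * n) (θ i) = k).card) :
    ∫ x in (-1 : ℝ)..1, p.eval x ^ 2
      ≤ 4 * Real.pi / m * ∑ i, p.eval (Real.cos (θ i)) ^ 2 * Real.sin (θ i) := by
  obtain ⟨g', h, hg'c, hhc, hderiv, hle, hint⟩ := exists_deriv_bound hn hp
  set G := ∫ x in (-1 : ℝ)..1, p.eval x ^ 2 with hG
  set g : ℝ → ℝ := fun θ => p.eval (Real.cos θ) ^ 2 * Real.sin θ with hg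
  set N := 48 * n with hN
  have hNpos : 0 < N := by omega
  have hN' : (0 : ℝ) < N := by exact_mod_cast hNpos
  have hm' : (0 : ℝ) < m := by exact_mod_cast hm
  have hpi := Real.pi_pos
  have hgc : Continuous g := continuous_iff_continuousAt.2 fun t => (hderiv t).continuousAt
  set L := Real.pi / N with hL
  have hLpos : 0 < L := by positivity
  let a : ℕ → ℝ := fun k => k * L
  have ha0 : a 0 = 0 := by simp [a]
  have haN : a N = Real.pi := by simp only [a, hL]; field_simp
  have hmono : ∀ k l, k ≤ l → a k ≤ a l := fun k l hkl => by
    simp only [a]; gcongr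
  have hlen : ∀ k, a (k + 1) - a k = L := fun k => by simp only [a]; push_cast; ring
  have hsum : ∀ f : ℝ → ℝ, Continuous f →
      ∑ k ∈ Finset.range N, ∫ t in a k..a (k + 1), f t = ∫ t in (0 : ℝ)..Real.pi, f t := by
    intro f hf
    rw [intervalIntegral.sum_integral_adjacent_intervals fun k _ => hf.intervalIntegrable _ _,
      ha0, haN]
  let I : ℕ → Finset (Fin m) := fun k => Finset.univ.filter fun i => arcIndex N (θ i) = k
  have hgnn : ∀ i, 0 ≤ g (θ i) := fun i =>
    mul_nonneg (sq_nonneg _) (Real.sin_nonneg_of_nonneg_of_le_pi (h0 i) (h1 i).le)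
  have harc : ∀ k < N, ∫ t in a k..a (k + 1), g t
      ≤ 2 * N / m * L * (∑ i ∈ I k, g (θ i)) + L * ∫ t in a k..a (k + 1), h t := by
    intro k hk
    -- Every sample in the arc satisfies `D ≤ L g(θ i)`. Averaging over the at least `m / (2N)`
    -- samples there gives the claim; a nonpositive `D` needs no sample.
    set D := (∫ t in a k..a (k + 1), g t) - L * ∫ t in a k..a (k + 1), h t with hD
    have hS : 0 ≤ ∑ i ∈ I k, g (θ i) := Finset.sum_nonneg fun i _ => hgnn i
    suffices D ≤ 2 * N / m * L * (∑ i ∈ I k, g (θ i)) by linarith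
    rcases le_total D 0 with hD0 | hD0
    · exact hD0.trans (by positivity)
    have h2 : (I k).card • D ≤ ∑ i ∈ I k, L * g (θ i) := by
      refine Finset.card_nsmul_le_sum _ _ _ fun i hi => ?_
      have hi' := (arcIndex_eq_iff hNpos (h0 i) k).1 (Finset.mem_filter.1 hi).2
      have hmem : θ i ∈ Icc (a k) (a (k + 1)) :=
        ⟨hi'.1, by simp only [a]; push_cast; exact hi'.2.le⟩
      have h3 := integral_le_eval_add hmem hderiv hg'c hhc fun t ht => hle t
        ⟨(ha0 ▸ hmono 0 k (Nat.zero_le k)).trans ht.1, ht.2.trans (haN ▸ hmono (k + 1) N hk)⟩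
      rw [hlen] at h3
      linarith
    rw [nsmul_eq_mul, ← Finset.mul_sum] at h2
    have h4 := mul_le_mul_of_nonneg_right (hcount k hk) hD0
    rw [div_mul_eq_mul_div, div_mul_eq_mul_div, le_div_iff₀ hm']
    nlinarith
  have htot : G ≤ 2 * N / m * L * (∑ i, g (θ i)) + L * ∫ t in (0 : ℝ)..Real.pi, h t := by
    have hG' : ∫ t in (0 : ℝ)..Real.pi, g t = G :=
      integral_cos_mul_sin (f := fun x => p.eval x ^ 2) (p.continuous.pow 2)
    have hfib : ∑ k ∈ Finset.range N, ∑ i ∈ I k, g (θ i) = ∑ i, g (θ i) :=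
      Finset.sum_fiberwise_of_maps_to
        (fun i _ => Finset.mem_range.2 (arcIndex_lt hNpos (h0 i) (h1 i))) _
    rw [← hG', ← hsum g hgc, ← hsum h hhc, ← hfib, Finset.mul_sum, Finset.mul_sum,
      ← Finset.sum_add_distrib]
    exact Finset.sum_le_sum fun k hk => harc k (Finset.mem_range.1 hk)
  have hG0 : 0 ≤ G := intervalIntegral.integral_nonneg (by norm_num) fun _ _ => sq_nonneg _
  -- This fixes the number 48: `6 n π / (48 n) = π / 8 ≤ 1/2`, so the derivative term is absorbed
  -- into the left side.
  have hLn : L * (6 * n) ≤ 1 / 2 := by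
    have : (N : ℝ) = 48 * n := by simp [hN]
    have hn0 : (0 : ℝ) < n := by exact_mod_cast hn
    rw [hL, this, div_mul_eq_mul_div, div_le_iff₀ (by positivity)]
    nlinarith [Real.pi_le_four]
  have hLh : L * ∫ t in (0 : ℝ)..Real.pi, h t ≤ 1 / 2 * G := by
    calc L * ∫ t in (0 : ℝ)..Real.pi, h t ≤ L * (6 * n * G) :=
          mul_le_mul_of_nonneg_left hint hLpos.le
      _ = L * (6 * n) * G := by ring
      _ ≤ _ := mul_le_mul_of_nonneg_right hLn hG0
  have hc : 2 * N / m * L = 2 * Real.pi / m := by rw [hL]; field_simp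
  rw [hc] at htot
  have : 4 * Real.pi / m * ∑ i, g (θ i) = 2 * (2 * Real.pi / m * ∑ i, g (θ i)) := by ring
  change G ≤ 4 * Real.pi / m * ∑ i, g (θ i)
  linarith

/-! ### Transfer to complex polynomials. -/

/-- Real and imaginary parts of a complex polynomial on the real line. -/
theorem exists_re_im {n : ℕ} {p : ℂ[X]} (hp : p ∈ polySpace n) :
    ∃ a b : ℝ[X], a ∈ Polynomial.degreeLT ℝ n ∧ b ∈ Polynomial.degreeLT ℝ n ∧
      ∀ x : ℝ, ‖polyFun p x‖ ^ 2 = a.eval x ^ 2 + b.eval x ^ 2 := by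
  have hcoeff : ∀ m, n ≤ m → p.coeff m = 0 := coeff_of_mem_degreeLT hp
  have hmem : ∀ r : ℕ → ℝ, (∑ i ∈ Finset.range n, Polynomial.C (r i) * Polynomial.X ^ i)
      ∈ Polynomial.degreeLT ℝ n := by
    intro r
    refine mem_degreeLT_of_coeff fun m hm => ?_
    rw [Polynomial.finsetSum_coeff]
    refine Finset.sum_eq_zero fun i hi => ?_
    rw [Polynomial.coeff_C_mul_X_pow, if_neg]
    have := Finset.mem_range.1 hi
    omega
  refine ⟨_, _, hmem fun i => (p.coeff i).re, hmem fun i => (p.coeff i).im, fun x => ?_⟩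
  have hev : polyFun p x = ∑ i ∈ Finset.range n, p.coeff i * (x : ℂ) ^ i := by
    rcases n.eq_zero_or_pos with rfl | hn
    · have : p = 0 := by ext m; simpa using hcoeff m (Nat.zero_le m)
      simp [this, polyFun]
    · refine Polynomial.eval_eq_sum_range' ?_ _
      by_contra! h
      have h0 := hcoeff _ h
      rw [Polynomial.coeff_natDegree, Polynomial.leadingCoeff_eq_zero] at h0
      simp [h0] at h
      omega
  have hre : (polyFun p x).re = ∑ i ∈ Finset.range n, (p.coeff i).re * x ^ i := by
    rw [hev, Complex.re_sum]
    refine Finset.sum_congr rfl fun i _ => ?_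
    rw [← Complex.ofReal_pow, Complex.re_mul_ofReal]
  have him : (polyFun p x).im = ∑ i ∈ Finset.range n, (p.coeff i).im * x ^ i := by
    rw [hev, Complex.im_sum]
    refine Finset.sum_congr rfl fun i _ => ?_
    rw [← Complex.ofReal_pow, Complex.im_mul_ofReal]
  rw [← Complex.normSq_eq_norm_sq, Complex.normSq_apply, hre, him]
  simp [Polynomial.eval_finsetSum, sq]

theorem continuous_polyFun (p : ℂ[X]) : Continuous (polyFun p) :=
  p.continuous.comp Complex.continuous_ofReal

theorem integral_eval_sq_add (a b : ℝ[X]) :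
    ∫ x in (-1 : ℝ)..1, (a.eval x ^ 2 + b.eval x ^ 2)
      = (∫ x in (-1 : ℝ)..1, a.eval x ^ 2) + ∫ x in (-1 : ℝ)..1, b.eval x ^ 2 :=
  intervalIntegral.integral_add ((a.continuous.pow 2).intervalIntegrable _ _)
    ((b.continuous.pow 2).intervalIntegrable _ _)

theorem norm_polyFun_sq_le {n : ℕ} {p : ℂ[X]} (hp : p ∈ polySpace n) {x : ℝ}
    (hx : x ∈ Icc (-1 : ℝ) 1) :
    ‖polyFun p x‖ ^ 2 ≤ (n : ℝ) ^ 2 * ∫ y in (-1 : ℝ)..1, ‖polyFun p y‖ ^ 2 := by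
  obtain ⟨a, b, ha, hb, hab⟩ := exists_re_im hp
  simp only [hab]
  rw [integral_eval_sq_add]
  linarith [eval_sq_le ha hx, eval_sq_le hb hx]

theorem integral_norm_polyFun_sq_le_sum {n m : ℕ} (hn : 1 ≤ n) (hm : 0 < m) {p : ℂ[X]}
    (hp : p ∈ polySpace n) (θ : Fin m → ℝ) (h0 : ∀ i, 0 ≤ θ i)
    (h1 : ∀ i, θ i < Real.pi)
    (hcount : ∀ k < 48 * n, (m : ℝ) ≤
      2 * (48 * n : ℕ) * (Finset.univ.filter fun i => arcIndex (48 * n) (θ i) = k).card) :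
    ∫ x in (-1 : ℝ)..1, ‖polyFun p x‖ ^ 2
      ≤ 4 * Real.pi / m * ∑ i, ‖polyFun p (Real.cos (θ i))‖ ^ 2 * Real.sin (θ i) := by
  obtain ⟨a, b, ha, hb, hab⟩ := exists_re_im hp
  simp only [hab, add_mul, Finset.sum_add_distrib, mul_add]
  rw [integral_eval_sq_add]
  exact add_le_add (integral_sq_le_sum hn hm ha θ h0 h1 hcount)
    (integral_sq_le_sum hn hm hb θ h0 h1 hcount)

/-! ### The shrinkage parameter, the rescaled arcsine measure and its weight. -/

/-- Bernoulli's inequality gives `2^(1/n) ≤ 1 + 1/n`, and `exp t ≥ 1 + t` with `log 2 ≥ 1/2` gives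
`2^(1/n) ≥ 1 + 1/(2n)`. The upper bound serves stability, the lower bound the cost. -/
theorem shrink_bounds {n : ℕ} (hn : 1 ≤ n) :
    1 / (64 * (n : ℝ) ^ 2) ≤ shrink n ∧ shrink n ≤ 1 / (16 * (n : ℝ) ^ 2) := by
  have hn' : (1 : ℝ) ≤ n := by exact_mod_cast hn
  have hn0 : (0 : ℝ) < n := by linarith
  have hup : (2 : ℝ) ^ (1 / (n : ℝ)) ≤ 1 + 1 / n := by
    have h := rpow_one_add_le_one_add_mul_self (s := 1) (by norm_num)
      (p := 1 / (n : ℝ)) (by positivity) (by rw [div_le_one hn0]; exact hn')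
    norm_num at h ⊢
    exact h
  have hlo : 1 + 1 / (2 * n) ≤ (2 : ℝ) ^ (1 / (n : ℝ)) := by
    rw [Real.rpow_def_of_pos (by norm_num)]
    have h1 := Real.add_one_le_exp (Real.log 2 * (1 / n))
    have h2 : 1 / 2 * (1 / (n : ℝ)) ≤ Real.log 2 * (1 / n) :=
      mul_le_mul_of_nonneg_right (by linarith [Real.log_two_gt_d9]) (by positivity)
    have h3 : 1 / (2 * (n : ℝ)) = 1 / 2 * (1 / n) := by field_simp
    linarith
  have e1 : 1 / (64 * (n : ℝ) ^ 2) = (1 / (2 * n)) ^ 2 / 16 := by field_simp; norm_num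
  have e2 : 1 / (16 * (n : ℝ) ^ 2) = (1 / n) ^ 2 / 16 := by field_simp
  have hpos : 0 < 1 / (2 * (n : ℝ)) := by positivity
  rw [e1, e2, shrink]
  constructor
  · gcongr
    linarith
  · gcongr
    · linarith
    · linarith

/-- The Lebesgue density of the rescaled arcsine measure on its support. -/
noncomputable def arcsineDensity (σ x : ℝ) : ℝ :=
  ((1 - σ) * Real.pi)⁻¹ * (1 - (x / (1 - σ)) ^ 2) ^ (-(1 / 2) : ℝ)

theorem measurable_arcsineDensity (σ : ℝ) :
    Measurable fun x => ENNReal.ofReal (arcsineDensity σ x) := by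
  unfold arcsineDensity
  fun_prop

theorem chebyshevMeasure_eq (σ : ℝ) : chebyshevMeasure σ =
    (volume.restrict (Ioo (-1 + σ) (1 - σ))).withDensity
      fun x => ENNReal.ofReal (arcsineDensity σ x) :=
  withDensity_indicator measurableSet_Ioo _

theorem ae_mem_chebyshevMeasure (σ : ℝ) :
    ∀ᵐ x ∂(chebyshevMeasure σ), x ∈ Ioo (-1 + σ) (1 - σ) := by
  rw [chebyshevMeasure_eq]
  exact (withDensity_absolutelyContinuous _ _).ae_le (ae_restrict_mem measurableSet_Ioo)

theorem chebyshevMeasure_eq_withDensity_uniform {σ : ℝ} (h0 : 0 ≤ σ) :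
    chebyshevMeasure σ = uniformMeasure.withDensity ((2 : ℝ≥0∞) •
      (Ioo (-1 + σ) (1 - σ)).indicator fun x => ENNReal.ofReal (arcsineDensity σ x)) := by
  have hm : Measurable
      ((Ioo (-1 + σ) (1 - σ)).indicator fun x => ENNReal.ofReal (arcsineDensity σ x)) :=
    (measurable_arcsineDensity σ).indicator measurableSet_Ioo
  rw [uniformMeasure, withDensity_smul _ hm, withDensity_smul_measure, smul_smul,
    ENNReal.mul_inv_cancel (by norm_num) (by norm_num), one_smul,
    withDensity_indicator measurableSet_Ioo, Measure.restrict_restrict measurableSet_Ioo,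
    inter_eq_left.2 (Ioo_subset_Ioo (by linarith) (by linarith)), chebyshevMeasure_eq]

theorem chebyshevMeasure_absolutelyContinuous {σ : ℝ} (h0 : 0 ≤ σ) :
    chebyshevMeasure σ ≪ uniformMeasure := by
  rw [chebyshevMeasure_eq_withDensity_uniform h0]
  exact withDensity_absolutelyContinuous _ _

instance isFiniteMeasure_uniformMeasure : IsFiniteMeasure uniformMeasure := by
  unfold uniformMeasure
  exact Measure.smul_finite _ (by norm_num)

/-- Substitution `x = (1 - σ) cos θ` in integrals against the rescaled arcsine measure. -/
theorem lintegral_chebyshevMeasure {σ : ℝ} (h1 : σ < 1) {F : ℝ → ℝ≥0∞} (hF : Measurable F) :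
    ∫⁻ x, F x ∂(chebyshevMeasure σ)
      = ENNReal.ofReal Real.pi⁻¹ * ∫⁻ θ in Ioo 0 Real.pi, F ((1 - σ) * Real.cos θ) := by
  have hρ : 0 < 1 - σ := by linarith
  have himage : (fun θ => (1 - σ) * Real.cos θ) '' Ioo 0 Real.pi = Ioo (-1 + σ) (1 - σ) := by
    ext x
    constructor
    · rintro ⟨θ, hθ, rfl⟩
      have hs := Real.sin_pos_of_pos_of_lt_pi hθ.1 hθ.2
      have hc : |Real.cos θ| < 1 := by
        rw [← sq_lt_one_iff_abs_lt_one]; nlinarith [Real.sin_sq_add_cos_sq θ]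
      have := abs_lt.1 hc
      constructor <;> simp only <;> nlinarith
    · rintro ⟨hx1, hx2⟩
      have hy1 : -1 < x / (1 - σ) := by rw [lt_div_iff₀ hρ]; linarith
      have hy2 : x / (1 - σ) < 1 := by rw [div_lt_iff₀ hρ]; linarith
      refine ⟨Real.arccos (x / (1 - σ)), ⟨Real.arccos_pos.2 hy2, ?_⟩, ?_⟩
      · refine lt_of_le_of_ne (Real.arccos_le_pi _) fun h => ?_
        rw [Real.arccos_eq_pi] at h
        linarith
      · simp only [Real.cos_arccos hy1.le hy2.le]
        field_simp
  have hinj : InjOn (fun θ => (1 - σ) * Real.cos θ) (Ioo 0 Real.pi) := fun a ha b hb hab =>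
    Real.injOn_cos (Ioo_subset_Icc_self ha) (Ioo_subset_Icc_self hb)
      (mul_left_cancel₀ hρ.ne' hab)
  have hden : Measurable fun x => ENNReal.ofReal (arcsineDensity σ x) :=
    measurable_arcsineDensity σ
  rw [chebyshevMeasure_eq, lintegral_withDensity_eq_lintegral_mul _ hden hF, ← himage,
    lintegral_image_eq_lintegral_abs_deriv_mul measurableSet_Ioo
      (fun θ _ => ((Real.hasDerivAt_cos θ).const_mul (1 - σ)).hasDerivWithinAt) hinj,
    ← lintegral_const_mul _ (by fun_prop)]
  refine setLIntegral_congr_fun measurableSet_Ioo fun θ hθ => ?_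
  have hs := Real.sin_pos_of_pos_of_lt_pi hθ.1 hθ.2
  simp only [Pi.mul_apply]
  rw [← mul_assoc, ← ENNReal.ofReal_mul (abs_nonneg _)]
  congr 2
  have e1 : (1 - σ) * Real.cos θ / (1 - σ) = Real.cos θ := by field_simp
  have e2 : 1 - Real.cos θ ^ 2 = Real.sin θ ^ (2 : ℝ) := by
    rw [Real.rpow_two]; linarith [Real.sin_sq_add_cos_sq θ]
  rw [arcsineDensity, e1, e2, ← Real.rpow_mul hs.le, abs_mul, abs_neg, abs_of_pos hρ,
    abs_of_pos hs]
  norm_num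
  rw [Real.rpow_neg_one]
  field_simp

theorem isProbabilityMeasure_chebyshevMeasure {σ : ℝ} (h1 : σ < 1) :
    IsProbabilityMeasure (chebyshevMeasure σ) := by
  constructor
  have h := lintegral_chebyshevMeasure h1 (F := fun _ => 1) measurable_const
  simp only [lintegral_const, one_mul, Measure.restrict_apply MeasurableSet.univ, univ_inter,
    Real.volume_Ioo, sub_zero] at h
  rw [h, ← ENNReal.ofReal_mul (by positivity), inv_mul_cancel₀ Real.pi_ne_zero, ENNReal.ofReal_one]

theorem measurable_arcIndex_arccos (N : ℕ) (σ : ℝ) :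
    Measurable fun x => arcIndex N (Real.arccos (x / (1 - σ))) := by
  unfold arcIndex
  exact Nat.measurable_floor.comp (((Real.continuous_arccos.measurable.comp
    (measurable_id.div_const _)).mul_const _).div_const _)

/-- The angle is uniformly distributed on `(0, π)`, so all arcs are equally likely. -/
theorem chebyshevMeasure_arc {σ : ℝ} (h1 : σ < 1) {N k : ℕ} (hk : k < N) :
    chebyshevMeasure σ {x | arcIndex N (Real.arccos (x / (1 - σ))) = k}
      = ENNReal.ofReal (1 / N) := by
  have hρ : 0 < 1 - σ := by linarith
  have hN : 0 < N := by omega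
  have hN' : (0 : ℝ) < N := by exact_mod_cast hN
  have hpi := Real.pi_pos
  have hS : MeasurableSet {x | arcIndex N (Real.arccos (x / (1 - σ))) = k} :=
    measurable_arcIndex_arccos N σ (measurableSet_singleton k)
  have hkN : ((k : ℝ) + 1) * (Real.pi / N) ≤ Real.pi := by
    have : (k : ℝ) + 1 ≤ N := by exact_mod_cast hk
    calc ((k : ℝ) + 1) * (Real.pi / N) ≤ N * (Real.pi / N) := by gcongr
      _ = Real.pi := by field_simp
  rw [← lintegral_indicator_one hS,
    lintegral_chebyshevMeasure h1 (measurable_one.indicator hS)]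
  have hcongr : ∫⁻ θ in Ioo 0 Real.pi, ({x | arcIndex N (Real.arccos (x / (1 - σ))) = k}.indicator
        (1 : ℝ → ℝ≥0∞)) ((1 - σ) * Real.cos θ)
      = ∫⁻ θ in Ioo 0 Real.pi,
        (Ico (k * (Real.pi / N)) ((k + 1) * (Real.pi / N))).indicator (1 : ℝ → ℝ≥0∞) θ := by
    refine setLIntegral_congr_fun measurableSet_Ioo fun θ hθ => ?_
    have e1 : (1 - σ) * Real.cos θ / (1 - σ) = Real.cos θ := by field_simp
    have e2 := Real.arccos_cos hθ.1.le hθ.2.le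
    simp only [indicator, mem_ofPred_eq, e1, e2, arcIndex_eq_iff hN hθ.1.le, mem_Ico, Pi.one_apply]
  rw [hcongr, lintegral_indicator_one measurableSet_Ico, Measure.restrict_apply measurableSet_Ico]
  have hvol : volume (Ico (k * (Real.pi / N)) ((k + 1) * (Real.pi / N)) ∩ Ioo 0 Real.pi)
      = ENNReal.ofReal (Real.pi / N) := by
    refine le_antisymm ?_ ?_
    · refine (measure_mono inter_subset_left).trans ?_
      rw [Real.volume_Ico]
      exact ENNReal.ofReal_le_ofReal (by linarith)
    · have hsub : Ioo (k * (Real.pi / N)) ((k + 1) * (Real.pi / N))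
          ⊆ Ico (k * (Real.pi / N)) ((k + 1) * (Real.pi / N)) ∩ Ioo 0 Real.pi := fun t ht =>
        ⟨Ioo_subset_Ico_self ht, lt_of_le_of_lt (by positivity) ht.1, ht.2.trans_le hkN⟩
      refine le_trans ?_ (measure_mono hsub)
      rw [Real.volume_Ioo]
      exact ENNReal.ofReal_le_ofReal (by linarith)
  rw [hvol, ← ENNReal.ofReal_mul (by positivity)]
  congr 1
  field_simp

/-- The weight function in closed form. -/
theorem weightFn_chebyshevMeasure_ae {σ : ℝ} (h0 : 0 ≤ σ) (h1 : σ < 1) :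
    ∀ᵐ x ∂(chebyshevMeasure σ), weightFn (chebyshevMeasure σ) uniformMeasure x
      = ENNReal.ofReal ((1 - σ) * (Real.pi / 2) * Real.sin (Real.arccos (x / (1 - σ)))) := by
  have hρ : 0 < 1 - σ := by linarith
  have hm : Measurable ((2 : ℝ≥0∞) •
      (Ioo (-1 + σ) (1 - σ)).indicator fun x => ENNReal.ofReal (arcsineDensity σ x)) :=
    ((measurable_arcsineDensity σ).indicator measurableSet_Ioo).const_smul _
  have hr := Measure.rnDeriv_withDensity uniformMeasure hm
  rw [← chebyshevMeasure_eq_withDensity_uniform h0] at hr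
  filter_upwards [(chebyshevMeasure_absolutelyContinuous h0).ae_le hr,
    ae_mem_chebyshevMeasure σ] with x hx hxI
  have hy1 : -1 < x / (1 - σ) := by rw [lt_div_iff₀ hρ]; linarith [hxI.1]
  have hy2 : x / (1 - σ) < 1 := by rw [div_lt_iff₀ hρ]; linarith [hxI.2]
  have hy : 0 < 1 - (x / (1 - σ)) ^ 2 := by nlinarith
  have hd : 0 < arcsineDensity σ x := by
    unfold arcsineDensity
    have := Real.rpow_pos_of_pos hy (-(1 / 2) : ℝ)
    have := Real.pi_pos
    positivity
  rw [weightFn, hx, Pi.smul_apply, indicator_of_mem hxI, smul_eq_mul,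
    show (2 : ℝ≥0∞) = ENNReal.ofReal 2 by simp, ← ENNReal.ofReal_mul (by norm_num),
    ← ENNReal.ofReal_inv_of_pos (by positivity), Real.sin_arccos, Real.sqrt_eq_rpow,
    arcsineDensity, Real.rpow_neg hy.le]
  congr 1
  field_simp

/-- Only an inequality: the density of `μ` vanishes on the end strips, where `0 * ∞ = 0` loses the
mass of `h`. -/
theorem lintegral_weightFn_mul_le {σ : ℝ} (h0 : 0 ≤ σ) (h1 : σ < 1) {h : ℝ → ℝ≥0∞}
    (hh : Measurable h) :
    ∫⁻ x, weightFn (chebyshevMeasure σ) uniformMeasure x * h x ∂(chebyshevMeasure σ)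
      ≤ ∫⁻ x, h x ∂uniformMeasure := by
  have := isProbabilityMeasure_chebyshevMeasure h1
  set ϱ := uniformMeasure
  set μ := chebyshevMeasure σ with hμ
  have hr : Measurable (μ.rnDeriv ϱ) := Measure.measurable_rnDeriv _ _
  have hd : ϱ.withDensity (μ.rnDeriv ϱ) = μ :=
    Measure.withDensity_rnDeriv_eq μ ϱ (chebyshevMeasure_absolutelyContinuous h0)
  calc ∫⁻ x, weightFn μ ϱ x * h x ∂μ
      = ∫⁻ x, weightFn μ ϱ x * h x ∂(ϱ.withDensity (μ.rnDeriv ϱ)) := by rw [hd]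
    _ = ∫⁻ x, μ.rnDeriv ϱ x * (weightFn μ ϱ x * h x) ∂ϱ :=
        lintegral_withDensity_eq_lintegral_mul _ hr (hr.inv.mul hh)
    _ ≤ ∫⁻ x, h x ∂ϱ := by
        refine lintegral_mono fun x => ?_
        rw [← mul_assoc]
        exact mul_le_of_le_one_left (zero_le) (ENNReal.mul_inv_le_one _)

/-! ### Concentration: Chernoff and Markov bounds for the samples. -/

instance isProbabilityMeasure_sampleLaw (μ : Measure ℝ) [IsProbabilityMeasure μ] (m : ℕ) :
    IsProbabilityMeasure (sampleLaw μ m) := by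
  unfold sampleLaw; infer_instance

theorem measurable_card_filter {m : ℕ} {A : Set ℝ} (hA : MeasurableSet A) [DecidablePred (· ∈ A)] :
    Measurable fun x : Fin m → ℝ => (((Finset.univ.filter fun i => x i ∈ A).card : ℕ) : ℝ) := by
  have : (fun x : Fin m → ℝ => (((Finset.univ.filter fun i => x i ∈ A).card : ℕ) : ℝ))
      = fun x => ∑ i, A.indicator (1 : ℝ → ℝ) (x i) := by
    funext x
    rw [Finset.card_filter]
    push_cast
    simp [indicator]
  rw [this]
  exact Finset.measurable_sum _ fun i _ => (measurable_one.indicator hA).comp (measurable_pi_apply i)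

/-- Multiplicative Chernoff bound for the lower tail of the number of samples in a set. -/
theorem sampleLaw_card_lt_le (μ : Measure ℝ) [IsProbabilityMeasure μ] (m : ℕ) {A : Set ℝ}
    (hA : MeasurableSet A) [DecidablePred (· ∈ A)] {q : ℝ} (hq : μ A = ENNReal.ofReal q)
    (hq0 : 0 ≤ q) :
    sampleLaw μ m {x | (((Finset.univ.filter fun i => x i ∈ A).card : ℕ) : ℝ) < m * q / 2}
      ≤ ENNReal.ofReal (Real.exp (-(m * q / 8))) := by
  set c : (Fin m → ℝ) → ℝ := fun x => (((Finset.univ.filter fun i => x i ∈ A).card : ℕ) : ℝ)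
    with hc
  -- The exponential moment with parameter `-1`, written as an affine function of the indicator. As
  -- `exp (-1) ≤ 3/8`, its mean is at most `exp (-5q/8)`; the threshold `m q / 2` leaves the
  -- exponent `-(5/8 - 1/2) m q = -m q / 8`.
  let g : ℝ → ℝ := fun x => 1 - (1 - Real.exp (-1)) * A.indicator (1 : ℝ → ℝ) x
  have he : Real.exp (-1) ≤ 3 / 8 := by
    rw [Real.exp_neg, inv_le_comm₀ (Real.exp_pos 1) (by norm_num)]
    linarith [Real.exp_one_gt_d9]
  have hg : ∀ x, g x = Real.exp (-(A.indicator (1 : ℝ → ℝ) x)) := by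
    intro x
    by_cases hx : x ∈ A <;> simp [g, hx]
  have hprod : ∀ x : Fin m → ℝ, ∏ i, g (x i) = Real.exp (-(c x)) := by
    intro x
    simp only [hg]
    rw [← Real.exp_sum, Finset.sum_neg_distrib]
    congr 2
    simp only [hc]
    rw [Finset.card_filter]
    push_cast
    simp [indicator]
  have hqr : μ.real A = q := by rw [Measure.real, hq, ENNReal.toReal_ofReal hq0]
  have hint : ∫ x, g x ∂μ = 1 - (1 - Real.exp (-1)) * q := by
    have hi : Integrable (A.indicator (1 : ℝ → ℝ)) μ := (integrable_const 1).indicator hA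
    simp only [g]
    rw [integral_sub (integrable_const _) (hi.const_mul _), integral_const_mul,
      integral_indicator_one hA, hqr]
    simp
  have hint0 : 0 ≤ ∫ x, g x ∂μ := integral_nonneg fun x => by
    change 0 ≤ g x
    rw [hg]; exact (Real.exp_pos _).le
  have hE : ∫ x, Real.exp (-(c x)) ∂(sampleLaw μ m) ≤ Real.exp (-(5 * (m * q) / 8)) := by
    simp only [← hprod]
    rw [sampleLaw, integral_fintype_prod_eq_prod (f := fun _ => g), Finset.prod_const,
      Finset.card_univ, Fintype.card_fin]
    have h1 : ∫ x, g x ∂μ ≤ Real.exp (-(5 * q / 8)) := by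
      rw [hint]
      have := Real.add_one_le_exp (-(5 * q / 8))
      nlinarith
    calc (∫ x, g x ∂μ) ^ m ≤ Real.exp (-(5 * q / 8)) ^ m := pow_le_pow_left₀ hint0 h1 m
      _ = Real.exp (-(5 * (m * q) / 8)) := by rw [← Real.exp_nat_mul]; congr 1; ring
  have hcm : Measurable c := measurable_card_filter hA
  have hI : Integrable (fun x => Real.exp (-(c x))) (sampleLaw μ m) := by
    refine Integrable.of_bound (hcm.neg.exp).aestronglyMeasurable 1 (ae_of_all _ fun x => ?_)
    rw [Real.norm_eq_abs, abs_of_pos (Real.exp_pos _), Real.exp_le_one_iff, neg_nonpos]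
    exact Nat.cast_nonneg _
  have hM := mul_meas_ge_le_integral_of_nonneg (μ := sampleLaw μ m)
    (f := fun x => Real.exp (-(c x))) (ae_of_all _ fun x => (Real.exp_pos _).le) hI
    (Real.exp (-(m * q / 2)))
  have hsub : {x | c x < m * q / 2} ⊆ {x | Real.exp (-(m * q / 2)) ≤ Real.exp (-(c x))} := by
    intro x hx
    have : c x < m * q / 2 := hx
    exact Real.exp_le_exp.2 (by linarith)
  refine (measure_mono hsub).trans ?_
  rw [← ofReal_measureReal]
  refine ENNReal.ofReal_le_ofReal ?_
  refine le_of_mul_le_mul_left (hM.trans (hE.trans ?_)) (Real.exp_pos (-(m * q / 2)))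
  rw [← Real.exp_add]
  exact Real.exp_le_exp.2 (by linarith)

open Classical in
/-- With high probability every arc contains at least half of its expected number of samples. -/
theorem sampleLaw_arc_card_lt {σ : ℝ} (h1 : σ < 1) {N : ℕ} (hN : 0 < N) (m : ℕ) :
    sampleLaw (chebyshevMeasure σ) m {x | ∃ k < N, 2 * (N : ℝ) * (Finset.univ.filter fun i =>
        arcIndex N (Real.arccos (x i / (1 - σ))) = k).card < m}
      ≤ ENNReal.ofReal (N * Real.exp (-(m / (8 * N)))) := by
  have := isProbabilityMeasure_chebyshevMeasure h1
  have hN' : (0 : ℝ) < N := by exact_mod_cast hN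
  have hset : {x : Fin m → ℝ | ∃ k < N, 2 * (N : ℝ) * (Finset.univ.filter fun i =>
        arcIndex N (Real.arccos (x i / (1 - σ))) = k).card < m}
      ⊆ ⋃ k ∈ Finset.range N, {x | (((Finset.univ.filter fun i =>
          x i ∈ {y | arcIndex N (Real.arccos (y / (1 - σ))) = k}).card : ℕ) : ℝ)
            < m * (1 / N) / 2} := by
    rintro x ⟨k, hk, hx⟩
    refine mem_iUnion₂.2 ⟨k, Finset.mem_range.2 hk, ?_⟩
    rw [mem_ofPred_eq, mul_one_div, div_div, lt_div_iff₀ (by positivity)]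
    simp only [mem_ofPred_eq]
    refine lt_of_eq_of_lt ?_ hx
    rw [mul_comm, mul_comm (N : ℝ) 2]
  refine (measure_mono hset).trans ((measure_biUnion_finset_le _ _).trans ?_)
  refine (Finset.sum_le_sum fun k hk => sampleLaw_card_lt_le (chebyshevMeasure σ) m
    (A := {y | arcIndex N (Real.arccos (y / (1 - σ))) = k})
    (measurable_arcIndex_arccos N σ (measurableSet_singleton k))
    (chebyshevMeasure_arc h1 (Finset.mem_range.1 hk)) (by positivity)).trans ?_
  rw [Finset.sum_const, Finset.card_range, nsmul_eq_mul, ENNReal.ofReal_mul hN'.le,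
    ENNReal.ofReal_natCast]
  refine le_of_eq ?_
  congr 4
  field_simp

/-- Markov's inequality for the empirical mean of a nonnegative function. -/
theorem sampleLaw_mean_gt_le (μ : Measure ℝ) [IsProbabilityMeasure μ] {m : ℕ} (hm : 0 < m)
    {F : ℝ → ℝ≥0∞} (hF : Measurable F) {R : ℝ≥0∞} (hR : ∫⁻ x, F x ∂μ ≤ R) (hRt : R ≠ ∞)
    {δ : ℝ} (hδ : 0 < δ) :
    sampleLaw μ m {x | ENNReal.ofReal δ⁻¹ * R < (m : ℝ≥0∞)⁻¹ * ∑ i, F (x i)}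
      ≤ ENNReal.ofReal δ := by
  have hmean : ∫⁻ x, (m : ℝ≥0∞)⁻¹ * ∑ i, F (x i) ∂(sampleLaw μ m) ≤ R := by
    have h : ∀ i : Fin m, ∫⁻ x, F (x i) ∂(sampleLaw μ m) = ∫⁻ x, F x ∂μ := fun i =>
      (measurePreserving_eval (fun _ : Fin m => μ) i).lintegral_comp hF
    rw [lintegral_const_mul _ (by fun_prop), lintegral_finsetSum _ (fun i _ => by fun_prop)]
    simp only [h, Finset.sum_const, Finset.card_univ, Fintype.card_fin, nsmul_eq_mul]
    rw [← mul_assoc, ENNReal.inv_mul_cancel (by exact_mod_cast hm.ne') (by simp), one_mul]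
    exact hR
  have hmeas : Measurable fun x : Fin m → ℝ => (m : ℝ≥0∞)⁻¹ * ∑ i, F (x i) := by fun_prop
  have hδt : ENNReal.ofReal δ⁻¹ ≠ 0 := by simpa using hδ
  -- The Markov argument below cancels `R`; when `R = 0` the empirical mean vanishes almost surely
  -- and the strict inequality fails.
  by_cases hR0 : R = 0
  · rw [hR0] at hmean ⊢
    have h0 := (lintegral_eq_zero_iff hmeas).1 (le_antisymm hmean (zero_le))
    have : sampleLaw μ m {x | ENNReal.ofReal δ⁻¹ * 0 < (m : ℝ≥0∞)⁻¹ * ∑ i, F (x i)} = 0 := by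
      refine measure_mono_null ?_ (ae_iff.1 h0)
      intro x hx
      rw [mem_ofPred_eq, mul_zero] at hx
      exact hx.ne'
    rw [this]
    exact zero_le
  · have h1 := mul_meas_ge_le_lintegral (μ := sampleLaw μ m) hmeas (ENNReal.ofReal δ⁻¹ * R)
    have h2 : sampleLaw μ m {x | ENNReal.ofReal δ⁻¹ * R < (m : ℝ≥0∞)⁻¹ * ∑ i, F (x i)}
        ≤ sampleLaw μ m {x | ENNReal.ofReal δ⁻¹ * R ≤ (m : ℝ≥0∞)⁻¹ * ∑ i, F (x i)} :=
      measure_mono fun x hx => (le_of_lt (mem_ofPred_eq ▸ hx) :)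
    refine h2.trans ?_
    have h3 := h1.trans hmean
    rw [mul_comm (ENNReal.ofReal δ⁻¹), mul_assoc] at h3
    have h4 : ENNReal.ofReal δ⁻¹ * sampleLaw μ m
        {x | R * ENNReal.ofReal δ⁻¹ ≤ (m : ℝ≥0∞)⁻¹ * ∑ i, F (x i)} ≤ 1 := by
      refine (ENNReal.mul_le_mul_iff_right hR0 hRt).1 ?_
      rw [mul_one]
      exact h3
    rw [mul_comm (ENNReal.ofReal δ⁻¹) R]
    rw [ENNReal.ofReal_inv_of_pos hδ] at h4 ⊢
    rwa [mul_comm, ← div_eq_mul_inv, ENNReal.div_le_iff (by simpa using hδ) (by simp),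
      one_mul] at h4

/-! ### Bounds for the mean cost. -/

/-- The left factor is bounded below by both `σ ≥ 1/(64 n²)` and `sin² θ ≥ u²/4`; their average and
`(u + d)² ≤ 2u² + 2d²` give `1/256`. Here `u` stands for the distance of `θ` to the nearer of `0`
and `π`. -/
theorem one_sub_sq_lower_bound {n : ℕ} (hn : 1 ≤ n) {θ u : ℝ} (hu0 : 0 ≤ u)
    (hu : 1 / 2 * u ≤ Real.sin θ) :
    1 / 256 * (u + 1 / n) ^ 2 ≤ 1 - ((1 - shrink n) * Real.cos θ) ^ 2 := by
  obtain ⟨hlo, hup⟩ := shrink_bounds hn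
  have hn' : (1 : ℝ) ≤ n := by exact_mod_cast hn
  have hn0 : (0 : ℝ) < n := by linarith
  have hup1 : 1 / (16 * (n : ℝ) ^ 2) ≤ 1 := by
    rw [div_le_one (by positivity)]; nlinarith
  have e : 1 / (64 * (n : ℝ) ^ 2) = 1 / 64 * (1 / n) ^ 2 := by field_simp
  rw [e] at hlo
  set σ := shrink n
  set d := 1 / (n : ℝ)
  have hd : 0 < d := by positivity
  have hσ0 : 0 ≤ σ := le_trans (by positivity) hlo
  have hσ1 : σ ≤ 1 := hup.trans hup1
  have hs2 := Real.sin_sq_add_cos_sq θ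
  have hu2 : 1 / 4 * u ^ 2 ≤ Real.sin θ ^ 2 := by nlinarith
  have hc : ((1 - σ) * Real.cos θ) ^ 2 ≤ (1 - σ) * Real.cos θ ^ 2 := by
    rw [mul_pow]
    exact mul_le_mul_of_nonneg_right (by nlinarith) (sq_nonneg _)
  have h1 : σ ≤ Real.sin θ ^ 2 + σ * Real.cos θ ^ 2 := by nlinarith [sq_nonneg (Real.sin θ)]
  have h2 : Real.sin θ ^ 2 ≤ Real.sin θ ^ 2 + σ * Real.cos θ ^ 2 := by
    nlinarith [sq_nonneg (Real.cos θ)]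
  nlinarith [sq_nonneg (u - d)]

/-- The cost model pulled back to the angle variable. -/
theorem cost_rpow_le {n : ℕ} (hn : 1 ≤ n) {α θ : ℝ} (hα : 0 ≤ α) (h0 : 0 ≤ θ)
    (h1 : θ ≤ Real.pi) :
    (1 - ((1 - shrink n) * Real.cos θ) ^ 2) ^ (-α) ≤
      256 ^ α * ((θ + 1 / n) ^ (-(2 * α)) + (Real.pi + 1 / n - θ) ^ (-(2 * α))) := by
  have hn0 : (0 : ℝ) < n := by exact_mod_cast hn
  have hd : 0 < 1 / (n : ℝ) := by positivity
  have hpi := Real.pi_pos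
  have key : ∀ u : ℝ, 0 ≤ u → u ≤ Real.pi / 2 → Real.sin u = Real.sin θ →
      (1 - ((1 - shrink n) * Real.cos θ) ^ 2) ^ (-α) ≤ 256 ^ α * (u + 1 / n) ^ (-(2 * α)) := by
    intro u hu0 hu1 hus
    have hs := Real.mul_le_sin hu0 hu1
    have h3 : 1 / 2 * u ≤ 2 / Real.pi * u := by
      refine mul_le_mul_of_nonneg_right ?_ hu0
      rw [div_le_div_iff₀ (by norm_num) hpi]
      linarith [Real.pi_le_four]
    have hb := one_sub_sq_lower_bound hn hu0 (h3.trans (hs.trans hus.le))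
    have hpos : 0 < u + 1 / n := by linarith
    calc _ ≤ (1 / 256 * (u + 1 / n) ^ 2) ^ (-α) :=
          Real.rpow_le_rpow_of_nonpos (by positivity) hb (by linarith)
      _ = _ := by
          rw [Real.mul_rpow (by norm_num) (by positivity), one_div, Real.inv_rpow (by norm_num),
            Real.rpow_neg (by norm_num), inv_inv, ← Real.rpow_natCast _ 2,
            ← Real.rpow_mul hpos.le]
          congr 2
          push_cast
          ring
  have hA : 0 ≤ (θ + 1 / n) ^ (-(2 * α)) := Real.rpow_nonneg (by linarith) _
  have hB : 0 ≤ (Real.pi + 1 / n - θ) ^ (-(2 * α)) := Real.rpow_nonneg (by linarith) _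
  have hC : (0 : ℝ) ≤ 256 ^ α := by positivity
  rcases le_total θ (Real.pi / 2) with h | h
  · exact (key θ h0 h rfl).trans (mul_le_mul_of_nonneg_left (by linarith) hC)
  · refine (key (Real.pi - θ) (by linarith) (by linarith) (Real.sin_pi_sub θ)).trans
      (mul_le_mul_of_nonneg_left ?_ hC)
    rw [show Real.pi - θ + 1 / (n : ℝ) = Real.pi + 1 / n - θ by ring]
    linarith

theorem lintegral_cost_le {n : ℕ} (hn : 1 ≤ n) {α A : ℝ} {c : ℝ → ℝ} (hα : 0 ≤ α)
    (hA : 0 ≤ A) (hc : Measurable c)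
    (hle : ∀ x ∈ Ioo (-1 : ℝ) 1, c x ≤ A * (1 - x ^ 2) ^ (-α)) :
    ∫⁻ x, ENNReal.ofReal (c x) ∂(chebyshevMeasure (shrink n)) ≤
      ENNReal.ofReal (A * 256 ^ α *
        ∫ t in (1 / n : ℝ)..(Real.pi + 1 / n), t ^ (-(2 * α))) := by
  obtain ⟨hlo, hup⟩ := shrink_bounds hn
  have hn' : (1 : ℝ) ≤ n := by exact_mod_cast hn
  have hn0 : (0 : ℝ) < n := by linarith
  have hpi := Real.pi_pos
  have hd : 0 < 1 / (n : ℝ) := by positivity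
  have hσ0 : 0 < shrink n := lt_of_lt_of_le (by positivity) hlo
  have hσ1 : shrink n < 1 := by
    refine hup.trans_lt ?_
    rw [div_lt_one (by positivity)]; nlinarith
  set r := -(2 * α) with hr
  set J := ∫ t in (1 / n : ℝ)..(Real.pi + 1 / n), t ^ r with hJ
  let G : ℝ → ℝ := fun θ => A * 256 ^ α * ((θ + 1 / n) ^ r + (Real.pi + 1 / n - θ) ^ r)
  have hc1 : ContinuousOn (fun θ : ℝ => (θ + 1 / n) ^ r) (uIcc 0 Real.pi) := by
    rw [uIcc_of_le hpi.le]
    exact ContinuousOn.rpow_const (by fun_prop) fun θ hθ => Or.inl (by linarith [hθ.1])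
  have hc2 : ContinuousOn (fun θ : ℝ => (Real.pi + 1 / n - θ) ^ r) (uIcc 0 Real.pi) := by
    rw [uIcc_of_le hpi.le]
    exact ContinuousOn.rpow_const (by fun_prop) fun θ hθ => Or.inl (by linarith [hθ.2])
  have hGi : IntervalIntegrable G volume 0 Real.pi :=
    ((hc1.add hc2).const_smul (A * 256 ^ α)).intervalIntegrable
  have hGint : ∫ θ in (0 : ℝ)..Real.pi, G θ = A * 256 ^ α * (2 * J) := by
    simp only [G]
    rw [intervalIntegral.integral_const_mul, intervalIntegral.integral_add hc1.intervalIntegrable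
      hc2.intervalIntegrable,
      intervalIntegral.integral_comp_add_right (fun t => t ^ r) (1 / (n : ℝ)),
      intervalIntegral.integral_comp_sub_left (fun t => t ^ r) (Real.pi + 1 / (n : ℝ)),
      zero_add, sub_zero, add_sub_cancel_left]
    ring
  have hG0 : ∀ θ ∈ Ioo 0 Real.pi, 0 ≤ G θ := fun θ hθ => by
    have h1 : 0 ≤ (θ + 1 / n) ^ r := Real.rpow_nonneg (by linarith [hθ.1]) _
    have h2 : 0 ≤ (Real.pi + 1 / n - θ) ^ r := Real.rpow_nonneg (by linarith [hθ.2]) _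
    simp only [G]
    positivity
  have hJ0 : 0 ≤ J := intervalIntegral.integral_nonneg (by linarith) fun t ht =>
    Real.rpow_nonneg (hd.le.trans ht.1) _
  rw [lintegral_chebyshevMeasure hσ1 (by fun_prop)]
  calc _ ≤ ENNReal.ofReal Real.pi⁻¹ * ∫⁻ θ in Ioo 0 Real.pi, ENNReal.ofReal (G θ) := by
        refine mul_le_mul' le_rfl ?_
        refine setLIntegral_mono' measurableSet_Ioo fun θ hθ => ENNReal.ofReal_le_ofReal ?_
        have hx : (1 - shrink n) * Real.cos θ ∈ Ioo (-1 : ℝ) 1 := by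
          have h1 := Real.neg_one_le_cos θ
          have h2 := Real.cos_le_one θ
          constructor <;> nlinarith
        refine (hle _ hx).trans ?_
        simp only [G]
        rw [mul_assoc]
        exact mul_le_mul_of_nonneg_left (cost_rpow_le hn hα hθ.1.le hθ.2.le) hA
    _ = ENNReal.ofReal Real.pi⁻¹ * ENNReal.ofReal (A * 256 ^ α * (2 * J)) := by
        rw [← hGint, intervalIntegral.integral_of_le hpi.le, integral_Ioc_eq_integral_Ioo,
          ofReal_integral_eq_lintegral_ofReal]
        · exact ((intervalIntegrable_iff_integrableOn_Ioo_of_le hpi.le).1 hGi)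
        · exact (ae_restrict_iff' measurableSet_Ioo).2 (ae_of_all _ hG0)
    _ ≤ _ := by
        rw [← ENNReal.ofReal_mul (by positivity)]
        refine ENNReal.ofReal_le_ofReal ?_
        have h2 : Real.pi⁻¹ * 2 ≤ 1 := by
          rw [inv_mul_le_iff₀ hpi]; linarith [Real.pi_gt_three]
        have h3 : 0 ≤ A * 256 ^ α * J := by positivity
        nlinarith

theorem integral_rpow_le_of_ne {n : ℕ} (hn : 1 ≤ n) {α : ℝ} (hα : 0 ≤ α) (h : α ≠ 1 / 2) :
    ∫ t in (1 / n : ℝ)..(Real.pi + 1 / n), t ^ (-(2 * α))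
      ≤ 5 / |1 - 2 * α| * (n : ℝ) ^ (max 1 (2 * α) - 1) := by
  have hn' : (1 : ℝ) ≤ n := by exact_mod_cast hn
  have hn0 : (0 : ℝ) < n := by linarith
  have hd : 0 < 1 / (n : ℝ) := by positivity
  have hd1 : 1 / (n : ℝ) ≤ 1 := by rw [div_le_one hn0]; exact hn'
  have hpi := Real.pi_pos
  have hne : -(2 * α) ≠ -1 := fun h' => h (by linarith)
  rw [integral_rpow (Or.inr ⟨hne, by
    rw [uIcc_of_le (by linarith)]; intro h0; linarith [h0.1]⟩),
    show -(2 * α) + 1 = 1 - 2 * α by ring]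
  have ha : 0 ≤ (1 / (n : ℝ)) ^ (1 - 2 * α) := by positivity
  have hb : 0 ≤ (Real.pi + 1 / n) ^ (1 - 2 * α) := by positivity
  rcases lt_or_gt_of_ne h with hlt | hgt
  · have hp : 0 < 1 - 2 * α := by linarith
    rw [abs_of_pos hp, max_eq_left (by linarith), sub_self, Real.rpow_zero, mul_one]
    refine div_le_div_of_nonneg_right ?_ hp.le
    have h5 : (Real.pi + 1 / n) ^ (1 - 2 * α) ≤ 5 := by
      calc (Real.pi + 1 / n) ^ (1 - 2 * α) ≤ 5 ^ (1 - 2 * α) :=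
            Real.rpow_le_rpow (by positivity) (by linarith [Real.pi_le_four]) hp.le
        _ ≤ 5 ^ (1 : ℝ) := Real.rpow_le_rpow_of_exponent_le (by norm_num) (by linarith)
        _ = 5 := Real.rpow_one 5
    linarith
  · have hp : 0 < 2 * α - 1 := by linarith
    have e1 : (1 / (n : ℝ)) ^ (1 - 2 * α) = (n : ℝ) ^ (2 * α - 1) := by
      rw [one_div, Real.inv_rpow hn0.le, ← Real.rpow_neg hn0.le]; congr 1; ring
    rw [abs_of_neg (by linarith), max_eq_right (by linarith),
      show -(1 - 2 * α) = 2 * α - 1 by ring, ← neg_div_neg_eq, neg_sub, neg_sub, e1,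
      div_mul_eq_mul_div]
    refine div_le_div_of_nonneg_right ?_ hp.le
    rw [e1] at ha
    linarith

theorem integral_rpow_le_of_eq {n : ℕ} (hn : 1 ≤ n) {α : ℝ} (h : α = 1 / 2) :
    ∫ t in (1 / n : ℝ)..(Real.pi + 1 / n), t ^ (-(2 * α)) ≤ 2 * Real.log (3 * n) := by
  have hn' : (1 : ℝ) ≤ n := by exact_mod_cast hn
  have hn0 : (0 : ℝ) < n := by linarith
  have hd : 0 < 1 / (n : ℝ) := by positivity
  have hpi := Real.pi_pos
  have e : ∀ t : ℝ, t ^ (-(2 * α)) = t⁻¹ := fun t => by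
    rw [h, show -(2 * (1 / 2 : ℝ)) = -1 by norm_num, Real.rpow_neg_one]
  simp only [e]
  rw [integral_inv_of_pos hd (by positivity)]
  have h3 : (Real.pi + 1 / n) / (1 / n) ≤ (3 * (n : ℝ)) ^ 2 := by
    rw [div_le_iff₀ hd]
    have : (3 * (n : ℝ)) ^ 2 * (1 / n) = 9 * n := by field_simp; norm_num
    have hd1 : 1 / (n : ℝ) ≤ 1 := by rw [div_le_one hn0]; exact hn'
    linarith [Real.pi_le_four]
  calc Real.log ((Real.pi + 1 / n) / (1 / n)) ≤ Real.log ((3 * (n : ℝ)) ^ 2) :=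
        Real.log_le_log (by positivity) h3
    _ = 2 * Real.log (3 * n) := by rw [Real.log_pow]; norm_num

/-! ### Weighted least squares as an orthogonal projection. -/

/-- Evaluation at weighted sample points as a linear map into Euclidean space. -/
noncomputable def sampleMap {m : ℕ} (ω : Fin m → ℝ) (x : Fin m → ℝ) :
    ℂ[X] →ₗ[ℂ] EuclideanSpace ℂ (Fin m) where
  toFun p := WithLp.toLp 2 fun i => (√(ω i) : ℂ) * polyFun p (x i)
  map_add' p q := by ext i; simp [polyFun, mul_add]
  map_smul' c p := by ext i; simp [polyFun]; ring

theorem norm_sub_sampleMap_sq {m : ℕ} {ω : Fin m → ℝ} (hω : ∀ i, 0 ≤ ω i) (x : Fin m → ℝ)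
    (y : Fin m → ℂ) (p : ℂ[X]) :
    ‖WithLp.toLp 2 (fun i => (√(ω i) : ℂ) * y i) - sampleMap ω x p‖ ^ 2
      = ∑ i, ω i * ‖y i - polyFun p (x i)‖ ^ 2 := by
  rw [EuclideanSpace.norm_sq_eq]
  refine Finset.sum_congr rfl fun i _ => ?_
  simp only [sampleMap, LinearMap.coe_mk, AddHom.coe_mk, PiLp.sub_apply]
  rw [← mul_sub, norm_mul, mul_pow, Complex.norm_real, Real.norm_eq_abs, sq_abs,
    Real.sq_sqrt (hω i)]

/-- Existence and uniqueness of weighted least-squares minimizers under injectivity of sampling. -/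
theorem exists_unique_leastSquares (P : Submodule ℂ ℂ[X]) {m : ℕ} {ω : Fin m → ℝ}
    (hω : ∀ i, 0 < ω i) (x : Fin m → ℝ) (y : Fin m → ℂ)
    (hinj : ∀ p ∈ P, (∀ i, polyFun p (x i) = 0) → p = 0) :
    ∃ fhat : ℂ[X], ∀ p : ℂ[X], (p ∈ P ∧ ∀ q ∈ P, ∑ i, ω i * ‖y i - polyFun p (x i)‖ ^ 2
      ≤ ∑ i, ω i * ‖y i - polyFun q (x i)‖ ^ 2) ↔ p = fhat := by
  set b : EuclideanSpace ℂ (Fin m) := WithLp.toLp 2 fun i => (√(ω i) : ℂ) * y i with hb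
  have hobj : ∀ p, ∑ i, ω i * ‖y i - polyFun p (x i)‖ ^ 2 = ‖b - sampleMap ω x p‖ ^ 2 :=
    fun p => (norm_sub_sampleMap_sq (fun i => (hω i).le) x y p).symm
  simp only [hobj]
  set S := P.map (sampleMap ω x)
  obtain ⟨f, hfP, hf⟩ := Submodule.mem_map.1 (S.starProjection_apply_mem b)
  -- Pythagoras around the projection of the data onto the image of `P`: `f` is a minimizer, and any
  -- other has the same samples, hence equals `f` by injectivity.
  have hpyth : ∀ q ∈ P, ‖b - sampleMap ω x q‖ ^ 2
      = ‖b - sampleMap ω x f‖ ^ 2 + ‖sampleMap ω x f - sampleMap ω x q‖ ^ 2 := by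
    intro q hq
    have hmem : sampleMap ω x f - sampleMap ω x q ∈ S :=
      S.sub_mem (Submodule.mem_map_of_mem hfP) (Submodule.mem_map_of_mem hq)
    have h0 : inner ℂ (b - sampleMap ω x f) (sampleMap ω x f - sampleMap ω x q) = 0 := by
      rw [hf] at hmem ⊢
      exact S.starProjection_inner_eq_zero b _ hmem
    have h1 := norm_add_sq_eq_norm_sq_add_norm_sq_of_inner_eq_zero _ _ h0
    rw [sub_add_sub_cancel] at h1
    simpa only [sq] using h1
  refine ⟨f, fun p => ⟨fun ⟨hpP, hp⟩ => ?_, ?_⟩⟩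
  · have h1 := hp f hfP
    rw [hpyth p hpP] at h1
    have h2 : ‖sampleMap ω x f - sampleMap ω x p‖ = 0 := by
      have := sq_nonneg ‖sampleMap ω x f - sampleMap ω x p‖
      exact pow_eq_zero_iff two_ne_zero |>.1 (by linarith)
    rw [norm_eq_zero, ← map_sub] at h2
    have h3 := hinj (f - p) (P.sub_mem hfP hpP) fun i => by
      have h4 := congrArg (fun v : EuclideanSpace ℂ (Fin m) => v i) h2
      simp only [sampleMap, LinearMap.coe_mk, AddHom.coe_mk, PiLp.zero_apply, mul_eq_zero,
        Complex.ofReal_eq_zero] at h4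
      exact h4.resolve_left (Real.sqrt_pos.2 (hω i)).ne'
    exact (sub_eq_zero.1 h3).symm
  · rintro rfl
    refine ⟨hfP, fun q hq => ?_⟩
    rw [hpyth q hq]
    linarith [sq_nonneg ‖sampleMap ω x p - sampleMap ω x q‖]

theorem enorm_sq_eq_ofReal (z : ℂ) : ‖z‖ₑ ^ 2 = ENNReal.ofReal (‖z‖ ^ 2) := by
  rw [← ofReal_norm, ENNReal.ofReal_pow (norm_nonneg _)]

theorem lsObjective_eq_ofReal {m : ℕ} (hm : 0 < m) {w : ℝ → ℝ≥0∞} {ω : Fin m → ℝ}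
    (hω : ∀ i, 0 ≤ ω i) (x : Fin m → ℝ) (hw : ∀ i, w (x i) = ENNReal.ofReal (ω i))
    (y : Fin m → ℂ) (p : ℂ[X]) :
    lsObjective w x y p
      = ENNReal.ofReal ((m : ℝ)⁻¹ * ∑ i, ω i * ‖y i - polyFun p (x i)‖ ^ 2) := by
  have hm' : (0 : ℝ) < m := by exact_mod_cast hm
  rw [lsObjective, ENNReal.ofReal_mul (by positivity), ENNReal.ofReal_inv_of_pos hm',
    ENNReal.ofReal_natCast,
    ENNReal.ofReal_sum_of_nonneg fun i _ => mul_nonneg (hω i) (sq_nonneg _)]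
  congr 1
  refine Finset.sum_congr rfl fun i _ => ?_
  rw [hw, enorm_sq_eq_ofReal, ENNReal.ofReal_mul (hω i)]

theorem exists_unique_isLeastSquaresFit (P : Submodule ℂ ℂ[X]) {m : ℕ} (hm : 0 < m)
    {w : ℝ → ℝ≥0∞} {ω : Fin m → ℝ}
    (hω : ∀ i, 0 < ω i) (x : Fin m → ℝ) (hw : ∀ i, w (x i) = ENNReal.ofReal (ω i))
    (hinj : ∀ p ∈ P, (∀ i, polyFun p (x i) = 0) → p = 0) (y : Fin m → ℂ) :
    ∃ fhat : ℂ[X], ∀ p : ℂ[X], IsLeastSquaresFit P w x y p ↔ p = fhat := by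
  obtain ⟨f, hf⟩ := exists_unique_leastSquares P hω x y hinj
  have hm' : (0 : ℝ) < (m : ℝ)⁻¹ := by positivity
  refine ⟨f, fun p => Iff.trans ?_ (hf p)⟩
  refine and_congr_right fun _ => forall₂_congr fun q _ => ?_
  rw [lsObjective_eq_ofReal hm (fun i => (hω i).le) x hw,
    lsObjective_eq_ofReal hm (fun i => (hω i).le) x hw, ENNReal.ofReal_le_ofReal_iff
      (mul_nonneg hm'.le (Finset.sum_nonneg fun i _ => mul_nonneg (hω i).le (sq_nonneg _)))]
  exact mul_le_mul_iff_right₀ hm'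

/-! ### Stability and deterministic error bounds. -/

/-- Stability of the weighted discrete norm: samples spread over all arcs control the `L²` norm. -/
theorem integral_norm_sq_le_discrete {n m : ℕ} (hn : 1 ≤ n) (hm : 0 < m) {x : Fin m → ℝ}
    (hx : ∀ i, x i ∈ Ioo (-1 + shrink n) (1 - shrink n))
    (hcount : ∀ k < 48 * n, (m : ℝ) ≤ 2 * (48 * n : ℕ) * (Finset.univ.filter fun i =>
      arcIndex (48 * n) (Real.arccos (x i / (1 - shrink n))) = k).card)
    {p : ℂ[X]} (hp : p ∈ polySpace n) :
    ∫ y in (-1 : ℝ)..1, ‖polyFun p y‖ ^ 2 ≤ 10 * ((m : ℝ)⁻¹ * ∑ i, ((1 - shrink n) *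
      (Real.pi / 2) * Real.sin (Real.arccos (x i / (1 - shrink n)))) * ‖polyFun p (x i)‖ ^ 2) := by
  obtain ⟨hlo, hup⟩ := shrink_bounds hn
  have hn' : (1 : ℝ) ≤ n := by exact_mod_cast hn
  have hn0 : (0 : ℝ) < n := by linarith
  set σ := shrink n
  have hσ0 : 0 < σ := lt_of_lt_of_le (by positivity) hlo
  have hσ1 : σ < 1 := by
    refine hup.trans_lt ?_
    rw [div_lt_one (by positivity)]; nlinarith
  have hρ : 0 < 1 - σ := by linarith
  have hσn : σ * (n : ℝ) ^ 2 ≤ 1 / 16 := by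
    rw [le_div_iff₀ (by positivity)] at hup
    linarith
  have hy : ∀ i, -1 < x i / (1 - σ) ∧ x i / (1 - σ) < 1 := fun i => by
    constructor
    · rw [lt_div_iff₀ hρ]; linarith [(hx i).1]
    · rw [div_lt_iff₀ hρ]; linarith [(hx i).2]
  -- Dilation moves the shortened interval to `[-1, 1]`, where the arc inequality applies; it bounds
  -- the integral over the shortened interval by `8 W`.
  set q : ℂ[X] := p.comp (Polynomial.C 0 + Polynomial.C ((1 - σ : ℝ) : ℂ) * Polynomial.X) with hq
  have hqmem : q ∈ polySpace n := comp_affine_mem hp _ _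
  have hqev : ∀ y : ℝ, polyFun q y = polyFun p ((1 - σ) * y) := fun y => by
    simp [polyFun, hq]
  have hMZ := integral_norm_polyFun_sq_le_sum hn hm hqmem
    (fun i => Real.arccos (x i / (1 - σ))) (fun i => Real.arccos_nonneg _)
    (fun i => lt_of_le_of_ne (Real.arccos_le_pi _) fun h => by
      rw [Real.arccos_eq_pi] at h; linarith [(hy i).1]) hcount
  have hback : ∀ i, (1 - σ) * Real.cos (Real.arccos (x i / (1 - σ))) = x i := fun i => by
    rw [Real.cos_arccos (hy i).1.le (hy i).2.le]; field_simp
  simp only [hqev, hback] at hMZ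
  set I := ∫ y in (-1 : ℝ)..1, ‖polyFun p y‖ ^ 2 with hI
  have hc : Continuous fun y => ‖polyFun p y‖ ^ 2 := (continuous_polyFun p).norm.pow 2
  have hii : ∀ a b, IntervalIntegrable (fun y => ‖polyFun p y‖ ^ 2) volume a b :=
    fun a b => hc.intervalIntegrable _ _
  have hmid := intervalIntegral.mul_integral_comp_mul_left (a := -1) (b := 1)
    (f := fun y => ‖polyFun p y‖ ^ 2) (1 - σ)
  rw [mul_one, mul_neg_one] at hmid
  -- The two strips together hold at most `I / 8`, so `7/8 I ≤ 8 W`, and `64/7 ≤ 10`.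
  have hend : ∀ a, -1 ≤ a → a + σ ≤ 1 → ∫ y in a..(a + σ), ‖polyFun p y‖ ^ 2 ≤ 1 / 16 * I := by
    intro a ha ha'
    calc ∫ y in a..(a + σ), ‖polyFun p y‖ ^ 2 ≤ ∫ _ in a..(a + σ), (n : ℝ) ^ 2 * I :=
          intervalIntegral.integral_mono_on (by linarith) (hii _ _)
            (continuous_const.intervalIntegrable _ _) fun y hy =>
              norm_polyFun_sq_le hp ⟨ha.trans hy.1, hy.2.trans ha'⟩
      _ = σ * (n : ℝ) ^ 2 * I := by
          rw [intervalIntegral.integral_const, smul_eq_mul]; ring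
      _ ≤ 1 / 16 * I := mul_le_mul_of_nonneg_right hσn
          (intervalIntegral.integral_nonneg (by norm_num) fun _ _ => sq_nonneg _)
  have e1 := hend (-1) le_rfl (by linarith)
  have e2 := hend (1 - σ) (by linarith) (by linarith)
  rw [sub_add_cancel] at e2
  have hsplit : I = (∫ y in (-1 : ℝ)..(-1 + σ), ‖polyFun p y‖ ^ 2)
      + (∫ y in (-(1 - σ))..(1 - σ), ‖polyFun p y‖ ^ 2)
      + ∫ y in (1 - σ)..1, ‖polyFun p y‖ ^ 2 := by
    rw [show -(1 - σ) = -1 + σ by ring, intervalIntegral.integral_add_adjacent_intervals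
      (hii _ _) (hii _ _), intervalIntegral.integral_add_adjacent_intervals (hii _ _) (hii _ _)]
  set W := (m : ℝ)⁻¹ * ∑ i, ((1 - σ) * (Real.pi / 2) * Real.sin (Real.arccos (x i / (1 - σ))))
    * ‖polyFun p (x i)‖ ^ 2 with hW
  have hW8 : (1 - σ) * (4 * Real.pi / m * ∑ i, ‖polyFun p (x i)‖ ^ 2 *
      Real.sin (Real.arccos (x i / (1 - σ)))) = 8 * W := by
    rw [hW, Finset.mul_sum, Finset.mul_sum, Finset.mul_sum, Finset.mul_sum]
    refine Finset.sum_congr rfl fun i _ => ?_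
    ring
  have hfin := mul_le_mul_of_nonneg_left hMZ hρ.le
  rw [hmid, hW8] at hfin
  have hW0 : 0 ≤ W := by
    refine mul_nonneg (by positivity) (Finset.sum_nonneg fun i _ => mul_nonneg
      (mul_nonneg (mul_nonneg hρ.le (by positivity)) ?_) (sq_nonneg _))
    exact Real.sin_nonneg_of_nonneg_of_le_pi (Real.arccos_nonneg _) (Real.arccos_le_pi _)
  linarith

theorem eq_zero_of_integral_norm_sq {n : ℕ} {p : ℂ[X]} (hp : p ∈ polySpace n)
    (h : ∫ y in (-1 : ℝ)..1, ‖polyFun p y‖ ^ 2 ≤ 0) : p = 0 := by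
  have hz : ∀ x ∈ Icc (-1 : ℝ) 1, polyFun p x = 0 := fun x hx => by
    have h1 := norm_polyFun_sq_le hp hx
    have h2 : ‖polyFun p x‖ ^ 2 ≤ 0 := h1.trans (mul_nonpos_of_nonneg_of_nonpos (by positivity) h)
    simpa using le_antisymm h2 (sq_nonneg _)
  refine Polynomial.eq_zero_of_infinite_isRoot p ?_
  refine ((Icc_infinite (by norm_num : (-1 : ℝ) < 1)).image
    Complex.ofReal_injective.injOn).mono ?_
  rintro _ ⟨x, hx, rfl⟩
  exact hz x hx

theorem eLpNorm_two_sq (g : ℝ → ℂ) (ϱ : Measure ℝ) :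
    eLpNorm g 2 ϱ ^ 2 = ∫⁻ x, ‖g x‖ₑ ^ 2 ∂ϱ := by
  have h := eLpNorm_nnreal_pow_eq_lintegral (f := g) (μ := ϱ) (p := 2) (by norm_num)
  simpa using h

theorem eLpNorm_polyFun_le {p : ℂ[X]} {B : ℝ} (hB : 0 ≤ B)
    (h : ∫ y in (-1 : ℝ)..1, ‖polyFun p y‖ ^ 2 ≤ B ^ 2) :
    eLpNorm (polyFun p) 2 uniformMeasure ≤ ENNReal.ofReal B := by
  rw [← ENNReal.pow_le_pow_left_iff (n := 2) two_ne_zero, eLpNorm_two_sq, uniformMeasure,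
    lintegral_smul_measure, ← ENNReal.ofReal_pow hB]
  have hc : Continuous fun y => ‖polyFun p y‖ ^ 2 := (continuous_polyFun p).norm.pow 2
  have e : ∫⁻ x in Ioo (-1 : ℝ) 1, ‖polyFun p x‖ₑ ^ 2
      = ENNReal.ofReal (∫ y in (-1 : ℝ)..1, ‖polyFun p y‖ ^ 2) := by
    simp only [enorm_sq_eq_ofReal]
    rw [intervalIntegral.integral_of_le (by norm_num), integral_Ioc_eq_integral_Ioo,
      ofReal_integral_eq_lintegral_ofReal]
    · exact (intervalIntegrable_iff_integrableOn_Ioo_of_le (by norm_num)).1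
        (hc.intervalIntegrable _ _)
    · exact ae_of_all _ fun _ => sq_nonneg _
  rw [e, smul_eq_mul]
  calc _ ≤ 1 * ENNReal.ofReal (∫ y in (-1 : ℝ)..1, ‖polyFun p y‖ ^ 2) :=
        mul_le_mul' (by simp) le_rfl
    _ ≤ _ := by rw [one_mul]; exact ENNReal.ofReal_le_ofReal h

/-- The passage from `L²` to `L^∞`, and the place where the factor `n` is really incurred. -/
theorem eLpNorm_top_polyFun_le {n : ℕ} {p : ℂ[X]} (hp : p ∈ polySpace n) {B : ℝ} (hB : 0 ≤ B)
    (h : ∫ y in (-1 : ℝ)..1, ‖polyFun p y‖ ^ 2 ≤ B ^ 2) :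
    eLpNorm (polyFun p) ∞ uniformMeasure ≤ ENNReal.ofReal (n * B) := by
  rw [eLpNorm_exponent_top]
  refine eLpNormEssSup_le_of_ae_bound ?_
  have h1 : ∀ᵐ x ∂uniformMeasure, x ∈ Ioo (-1 : ℝ) 1 :=
    Measure.smul_absolutelyContinuous.ae_le (ae_restrict_mem measurableSet_Ioo)
  filter_upwards [h1] with x hx
  refine le_of_sq_le_sq ((norm_polyFun_sq_le hp (Ioo_subset_Icc_self hx)).trans ?_)
    (by positivity)
  rw [mul_pow]
  exact mul_le_mul_of_nonneg_left h (by positivity)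

theorem sum_weighted_add_sq_le {m : ℕ} {ω : Fin m → ℝ} (hω : ∀ i, 0 ≤ ω i) (u v : Fin m → ℂ) :
    ∑ i, ω i * ‖u i + v i‖ ^ 2 ≤ 2 * ∑ i, ω i * ‖u i‖ ^ 2 + 2 * ∑ i, ω i * ‖v i‖ ^ 2 := by
  rw [Finset.mul_sum, Finset.mul_sum, ← Finset.sum_add_distrib]
  refine Finset.sum_le_sum fun i _ => ?_
  have h1 : ‖u i + v i‖ ^ 2 ≤ 2 * ‖u i‖ ^ 2 + 2 * ‖v i‖ ^ 2 := by
    have h2 := norm_add_le (u i) (v i)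
    nlinarith [norm_nonneg (u i + v i), sq_nonneg (‖u i‖ - ‖v i‖)]
  nlinarith [mul_le_mul_of_nonneg_left h1 (hω i)]

/-- Deterministic error bound for a weighted least-squares fit at stable sample points. -/
theorem integral_sub_sq_le {n m : ℕ} (hn : 1 ≤ n) (hm : 0 < m) {x : Fin m → ℝ}
    (hx : ∀ i, x i ∈ Ioo (-1 + shrink n) (1 - shrink n))
    (hcount : ∀ k < 48 * n, (m : ℝ) ≤ 2 * (48 * n : ℕ) * (Finset.univ.filter fun i =>
      arcIndex (48 * n) (Real.arccos (x i / (1 - shrink n))) = k).card)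
    {ω : Fin m → ℝ} (hω : ∀ i, ω i = (1 - shrink n) * (Real.pi / 2) *
      Real.sin (Real.arccos (x i / (1 - shrink n)))) (hω0 : ∀ i, 0 ≤ ω i) (hω2 : ∀ i, ω i ≤ 2)
    (y : Fin m → ℂ) (e : EuclideanSpace ℂ (Fin m)) {p q : ℂ[X]} (hp : p ∈ polySpace n)
    (hq : q ∈ polySpace n) (hle : ∑ i, ω i * ‖y i + e i - polyFun p (x i)‖ ^ 2
      ≤ ∑ i, ω i * ‖y i + e i - polyFun q (x i)‖ ^ 2) :
    ∫ t in (-1 : ℝ)..1, ‖polyFun (q - p) t‖ ^ 2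
      ≤ 80 * ((m : ℝ)⁻¹ * ∑ i, ω i * ‖y i - polyFun q (x i)‖ ^ 2) + 160 * ‖e‖ ^ 2 := by
  have h1 := integral_norm_sq_le_discrete hn hm hx hcount
    (show q - p ∈ polySpace n from Submodule.sub_mem _ hq hp)
  simp only [← hω] at h1
  have hsub : ∀ i, polyFun (q - p) (x i)
      = (y i + e i - polyFun p (x i)) + -(y i + e i - polyFun q (x i)) := fun i => by
    simp [polyFun]
  have h2 := sum_weighted_add_sq_le hω0 (fun i => y i + e i - polyFun p (x i))
    (fun i => -(y i + e i - polyFun q (x i)))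
  simp only [norm_neg, ← hsub] at h2
  have h3 := sum_weighted_add_sq_le hω0 (fun i => y i - polyFun q (x i)) e
  have hadd : ∀ i, y i + e i - polyFun q (x i) = y i - polyFun q (x i) + e i := fun i => by ring
  simp only [← hadd] at h3
  have hm1 : (1 : ℝ) ≤ m := by exact_mod_cast hm
  have hinv0 : 0 ≤ (m : ℝ)⁻¹ := by positivity
  have hinv1 : (m : ℝ)⁻¹ ≤ 1 := inv_le_one_of_one_le₀ hm1
  -- The averaging factor `1/m` is simply bounded by 1, since the noise enters the theorem through
  -- its unnormalized norm.
  have he : (m : ℝ)⁻¹ * ∑ i, ω i * ‖e i‖ ^ 2 ≤ 2 * ‖e‖ ^ 2 := by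
    rw [EuclideanSpace.norm_sq_eq]
    have hs : 0 ≤ ∑ i, ω i * ‖e i‖ ^ 2 :=
      Finset.sum_nonneg fun i _ => mul_nonneg (hω0 i) (sq_nonneg _)
    calc _ ≤ 1 * ∑ i, ω i * ‖e i‖ ^ 2 := mul_le_mul_of_nonneg_right hinv1 hs
      _ ≤ 2 * ∑ i, ‖e i‖ ^ 2 := by
          rw [one_mul, Finset.mul_sum]
          exact Finset.sum_le_sum fun i _ => mul_le_mul_of_nonneg_right (hω2 i) (sq_nonneg _)
  have h4 := mul_le_mul_of_nonneg_left (h2.trans (by linarith :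
    _ ≤ 8 * (∑ i, ω i * ‖y i - polyFun q (x i)‖ ^ 2) + 8 * ∑ i, ω i * ‖e i‖ ^ 2)) hinv0
  nlinarith

/-! ### Sample size, good event and assembly. -/

theorem expectedCost_chebyshev_le {n m : ℕ} (hn : 1 ≤ n) {α A M J : ℝ} {c : ℝ → ℝ}
    (hα : 0 ≤ α) (hc : Measurable c)
    (hle : ∀ x ∈ Ioo (-1 : ℝ) 1, 0 < c x ∧ c x ≤ A * (1 - x ^ 2) ^ (-α)) (hm : (m : ℝ) ≤ M)
    (hJ : ∫ t in (1 / n : ℝ)..(Real.pi + 1 / n), t ^ (-(2 * α)) ≤ J) :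
    expectedCost c (chebyshevMeasure (shrink n)) m ≤ ENNReal.ofReal (M * (A * 256 ^ α * J)) := by
  obtain ⟨hlo, hup⟩ := shrink_bounds hn
  have hn' : (1 : ℝ) ≤ n := by exact_mod_cast hn
  have hσ1 : shrink n < 1 := by
    refine hup.trans_lt ?_
    rw [div_lt_one (by positivity)]; nlinarith
  have hA : 0 ≤ A := by
    have h := hle 0 (by norm_num)
    norm_num at h
    linarith
  have := isProbabilityMeasure_chebyshevMeasure hσ1
  rw [expectedCost_eq c hc, ENNReal.ofReal_mul ((Nat.cast_nonneg m).trans hm)]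
  refine mul_le_mul' ?_ ((lintegral_cost_le hn hα hA hc fun x hx => (hle x hx).2).trans
    (ENNReal.ofReal_le_ofReal ?_))
  · rw [← ENNReal.ofReal_natCast]
    exact ENNReal.ofReal_le_ofReal hm
  · exact mul_le_mul_of_nonneg_left hJ (by positivity)

theorem one_le_log {n : ℕ} (hn : 1 ≤ n) {ε : ℝ} (h0 : 0 < ε) (h1 : ε < 1) :
    1 ≤ Real.log (3 * n / ε) := by
  have hn' : (1 : ℝ) ≤ n := by exact_mod_cast hn
  rw [Real.le_log_iff_exp_le (by positivity), le_div_iff₀ h0]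
  have := Real.exp_one_lt_d9
  nlinarith [Real.exp_pos 1]

/-- Since `1920 = 5 · 8 · 48`, the exponential is at most `(ε / 3n)⁵`. One factor cancels the number
`48 n` of arcs, and the other four supply `16 / 81 ≤ 1/2`. -/
theorem arc_failure_le {n m : ℕ} (hn : 1 ≤ n) {ε : ℝ} (h0 : 0 < ε) (h1 : ε < 1)
    (hm : 1920 * n * Real.log (3 * n / ε) ≤ m) :
    ((48 * n : ℕ) : ℝ) * Real.exp (-(m / (8 * (48 * n : ℕ)))) ≤ ε / 2 := by
  have hn' : (1 : ℝ) ≤ n := by exact_mod_cast hn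
  have hn0 : (0 : ℝ) < n := by linarith
  have hexp : Real.exp (-(m / (8 * (48 * n : ℕ)))) ≤ (ε / (3 * n)) ^ 5 := by
    have e : (ε / (3 * n)) ^ 5 = Real.exp (-(5 * Real.log (3 * n / ε))) := by
      rw [Real.exp_neg, show (5 : ℝ) = (5 : ℕ) by norm_num, Real.exp_nat_mul,
        Real.exp_log (by positivity), ← inv_pow, inv_div]
    rw [e]
    refine Real.exp_le_exp.2 (neg_le_neg ?_)
    push_cast
    rw [le_div_iff₀ (by positivity)]
    linarith
  have hb : ε / (3 * n) ≤ 1 / 3 := by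
    rw [div_le_div_iff₀ (by positivity) (by norm_num)]
    nlinarith
  have hb4 : (ε / (3 * n)) ^ 4 ≤ (1 / 3) ^ 4 := pow_le_pow_left₀ (by positivity) hb 4
  calc _ ≤ ((48 * n : ℕ) : ℝ) * (ε / (3 * n)) ^ 5 := by gcongr
    _ = 16 * ε * (ε / (3 * n)) ^ 4 := by push_cast; field_simp; ring
    _ ≤ 16 * ε * (1 / 3) ^ 4 := by gcongr
    _ ≤ ε / 2 := by linarith

/-- The high-probability event on which the samples are stable and the residual is controlled. -/
theorem exists_good_event {n m : ℕ} (hn : 1 ≤ n) (hm : 0 < m) {ε : ℝ} (h0 : 0 < ε) (h1 : ε < 1)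
    (hmL : 1920 * n * Real.log (3 * n / ε) ≤ m) {f : ℝ → ℂ} (hf : MemLp f 2 uniformMeasure)
    (q : ℂ[X]) (hR : errNorm uniformMeasure 2 f q ≠ ∞) :
    ∃ E : Set (Fin m → ℝ), MeasurableSet E ∧
      ENNReal.ofReal (1 - ε) ≤ sampleLaw (chebyshevMeasure (shrink n)) m E ∧
      ∀ x ∈ E, (∀ i, x i ∈ Ioo (-1 + shrink n) (1 - shrink n)) ∧
        (∀ i, weightFn (chebyshevMeasure (shrink n)) uniformMeasure (x i) =
          ENNReal.ofReal ((1 - shrink n) * (Real.pi / 2) *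
            Real.sin (Real.arccos (x i / (1 - shrink n))))) ∧
        (∀ k < 48 * n, (m : ℝ) ≤ 2 * (48 * n : ℕ) * (Finset.univ.filter fun i =>
          arcIndex (48 * n) (Real.arccos (x i / (1 - shrink n))) = k).card) ∧
        lsObjective (weightFn (chebyshevMeasure (shrink n)) uniformMeasure) x (fun i => f (x i)) q
          ≤ ENNReal.ofReal (2 / ε) * errNorm uniformMeasure 2 f q ^ 2 := by
  classical
  obtain ⟨hlo, hup⟩ := shrink_bounds hn
  have hn' : (1 : ℝ) ≤ n := by exact_mod_cast hn
  set σ := shrink n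
  have hσ0 : 0 < σ := lt_of_lt_of_le (by positivity) hlo
  have hσ1 : σ < 1 := by
    refine hup.trans_lt ?_
    rw [div_lt_one (by positivity)]; nlinarith
  have hprob := isProbabilityMeasure_chebyshevMeasure hσ1
  set μ := chebyshevMeasure σ with hμ
  set w := weightFn μ uniformMeasure with hw
  have hwm : Measurable w := (Measure.measurable_rnDeriv _ _).inv
  have hgm : AEStronglyMeasurable (fun x => f x - polyFun q x) uniformMeasure :=
    hf.1.sub (continuous_polyFun q).aestronglyMeasurable
  -- `f` is only almost everywhere measurable, so Markov's inequality is applied to a measurable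
  -- version of the residual. Samples where the versions differ go into the null set `bad1`,
  -- together with exceptional points of the support and of the weight formula.
  set g := hgm.mk _ with hg
  have hgmeas : Measurable g := hgm.stronglyMeasurable_mk.measurable
  let F : ℝ → ℝ≥0∞ := fun x => w x * ‖g x‖ₑ ^ 2
  have hF : Measurable F := by fun_prop
  have hFint : ∫⁻ x, F x ∂μ ≤ errNorm uniformMeasure 2 f q ^ 2 := by
    refine (lintegral_weightFn_mul_le hσ0.le hσ1 (by fun_prop)).trans (le_of_eq ?_)
    rw [errNorm, eLpNorm_two_sq]
    refine lintegral_congr_ae ?_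
    filter_upwards [hgm.ae_eq_mk] with x hx
    rw [hx]
  let good : ℝ → Prop := fun x => x ∈ Ioo (-1 + σ) (1 - σ) ∧
    w x = ENNReal.ofReal ((1 - σ) * (Real.pi / 2) * Real.sin (Real.arccos (x / (1 - σ)))) ∧
    f x - polyFun q x = g x
  have hgood : ∀ᵐ x ∂μ, good x := by
    filter_upwards [ae_mem_chebyshevMeasure σ, weightFn_chebyshevMeasure_ae hσ0.le hσ1,
      (chebyshevMeasure_absolutelyContinuous hσ0.le).ae_le hgm.ae_eq_mk] with x hx1 hx2 hx3
    exact ⟨hx1, hx2, hx3⟩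
  have hgoodall : ∀ᵐ x ∂(sampleLaw μ m), ∀ i, good (x i) := by
    rw [ae_all_iff]
    intro i
    exact (measurePreserving_eval (fun _ : Fin m => μ) i).quasiMeasurePreserving.ae hgood
  set bad1 : Set (Fin m → ℝ) := {x | ¬ ∀ i, good (x i)}
  set bad2 : Set (Fin m → ℝ) := {x | ∃ k < 48 * n, 2 * ((48 * n : ℕ) : ℝ) *
    (Finset.univ.filter fun i => arcIndex (48 * n) (Real.arccos (x i / (1 - σ))) = k).card < m}
  set bad3 : Set (Fin m → ℝ) := {x | ENNReal.ofReal (ε / 2)⁻¹ * errNorm uniformMeasure 2 f q ^ 2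
    < (m : ℝ≥0∞)⁻¹ * ∑ i, F (x i)}
  have hb1 : sampleLaw μ m bad1 = 0 := ae_iff.1 hgoodall
  have hb2 : sampleLaw μ m bad2 ≤ ENNReal.ofReal (ε / 2) :=
    (sampleLaw_arc_card_lt hσ1 (by omega) m).trans
      (ENNReal.ofReal_le_ofReal (arc_failure_le hn h0 h1 hmL))
  have hb3 : sampleLaw μ m bad3 ≤ ENNReal.ofReal (ε / 2) :=
    sampleLaw_mean_gt_le μ hm hF hFint (ENNReal.pow_ne_top hR) (by positivity)
  have hbad : sampleLaw μ m (bad1 ∪ bad2 ∪ bad3) ≤ ENNReal.ofReal ε := by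
    calc _ ≤ sampleLaw μ m bad1 + sampleLaw μ m bad2 + sampleLaw μ m bad3 :=
          (measure_union_le _ _).trans (add_le_add (measure_union_le _ _) le_rfl)
      _ ≤ 0 + ENNReal.ofReal (ε / 2) + ENNReal.ofReal (ε / 2) := by
          rw [hb1]; exact add_le_add (add_le_add le_rfl hb2) hb3
      _ = ENNReal.ofReal ε := by
          rw [zero_add, ← ENNReal.ofReal_add (by positivity) (by positivity)]; congr 1; ring
  -- `bad1` need not be measurable, so the bad set is replaced by a measurable hull of equal
  -- measure. The event depends on `f` but not on the noise.
  refine ⟨(toMeasurable (sampleLaw μ m) (bad1 ∪ bad2 ∪ bad3))ᶜ,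
    (measurableSet_toMeasurable _ _).compl, ?_, ?_⟩
  · rw [prob_compl_eq_one_sub (measurableSet_toMeasurable _ _), measure_toMeasurable,
      ENNReal.ofReal_sub _ h0.le, ENNReal.ofReal_one]
    exact tsub_le_tsub_left hbad 1
  · intro x hx
    have hx' : x ∉ bad1 ∪ bad2 ∪ bad3 := fun h => hx (subset_toMeasurable _ _ h)
    have hx1 : ∀ i, good (x i) := by
      by_contra h
      exact hx' (Or.inl (Or.inl h))
    refine ⟨fun i => (hx1 i).1, fun i => (hx1 i).2.1, fun k hk => ?_, ?_⟩
    · by_contra! h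
      exact hx' (Or.inl (Or.inr ⟨k, hk, h⟩))
    · have h4 : (m : ℝ≥0∞)⁻¹ * ∑ i, F (x i) ≤
          ENNReal.ofReal (ε / 2)⁻¹ * errNorm uniformMeasure 2 f q ^ 2 :=
        not_lt.1 fun h => hx' (Or.inr h)
      rw [inv_div] at h4
      refine le_trans (le_of_eq ?_) h4
      rw [lsObjective]
      congr 1
      refine Finset.sum_congr rfl fun i _ => ?_
      simp only [F, (hx1 i).2.2]

theorem errNorm_ne_top {f : ℝ → ℂ} (hf : MemLp f 2 uniformMeasure) (q : ℂ[X]) :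
    errNorm uniformMeasure 2 f q ≠ ∞ := by
  have hq : eLpNorm (polyFun q) 2 uniformMeasure ≠ ∞ := by
    refine ne_top_of_le_ne_top ENNReal.ofReal_ne_top (eLpNorm_polyFun_le (p := q)
      (B := √(∫ y in (-1 : ℝ)..1, ‖polyFun q y‖ ^ 2)) (Real.sqrt_nonneg _) ?_)
    rw [Real.sq_sqrt (intervalIntegral.integral_nonneg (by norm_num) fun _ _ => sq_nonneg _)]
  exact ((hf.sub ⟨(continuous_polyFun q).aestronglyMeasurable, hq.lt_top⟩).2).ne

/-- On the good event the weighted least-squares fit exists, is unique and is accurate. -/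
theorem leastSquares_accuracy {n m : ℕ} (hn : 1 ≤ n) (hm : 0 < m) {ε : ℝ} (h0 : 0 < ε)
    (h1 : ε < 1) {f : ℝ → ℂ} (hf : MemLp f 2 uniformMeasure) {q : ℂ[X]} (hq : q ∈ polySpace n)
    {x : Fin m → ℝ} (hx : ∀ i, x i ∈ Ioo (-1 + shrink n) (1 - shrink n))
    (hw : ∀ i, weightFn (chebyshevMeasure (shrink n)) uniformMeasure (x i) =
      ENNReal.ofReal ((1 - shrink n) * (Real.pi / 2) *
        Real.sin (Real.arccos (x i / (1 - shrink n)))))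
    (hcount : ∀ k < 48 * n, (m : ℝ) ≤ 2 * (48 * n : ℕ) * (Finset.univ.filter fun i =>
      arcIndex (48 * n) (Real.arccos (x i / (1 - shrink n))) = k).card)
    (hobj : lsObjective (weightFn (chebyshevMeasure (shrink n)) uniformMeasure) x
      (fun i => f (x i)) q ≤ ENNReal.ofReal (2 / ε) * errNorm uniformMeasure 2 f q ^ 2)
    (e : EuclideanSpace ℂ (Fin m)) :
    ∃ fhat : ℂ[X], (∀ p : ℂ[X], IsLeastSquaresFit (polySpace n)
        (weightFn (chebyshevMeasure (shrink n)) uniformMeasure)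
        x (fun i => f (x i) + e i) p ↔ p = fhat) ∧
      errNorm uniformMeasure 2 f fhat ≤
        ENNReal.ofReal (14 * (n / √ε)) * (errNorm uniformMeasure 2 f q + ‖e‖ₑ) ∧
      errNorm uniformMeasure ∞ f fhat ≤
        ENNReal.ofReal 14 * (errNorm uniformMeasure ∞ f q +
          ENNReal.ofReal (n / √ε) * (errNorm uniformMeasure 2 f q + ‖e‖ₑ)) := by
  obtain ⟨hlo, hup⟩ := shrink_bounds hn
  have hn' : (1 : ℝ) ≤ n := by exact_mod_cast hn
  have hσ0 : 0 < shrink n := lt_of_lt_of_le (by positivity) hlo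
  have hσ1 : shrink n < 1 := by
    refine hup.trans_lt ?_
    rw [div_lt_one (by positivity)]; nlinarith
  have hρ : 0 < 1 - shrink n := by linarith
  have hpi := Real.pi_pos
  set ω : Fin m → ℝ := fun i => (1 - shrink n) * (Real.pi / 2) *
    Real.sin (Real.arccos (x i / (1 - shrink n))) with hωdef
  have hω : ∀ i, 0 < ω i := fun i => by
    have hy1 : -1 < x i / (1 - shrink n) := by rw [lt_div_iff₀ hρ]; linarith [(hx i).1]
    have hy2 : x i / (1 - shrink n) < 1 := by rw [div_lt_iff₀ hρ]; linarith [(hx i).2]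
    have hs : 0 < Real.sin (Real.arccos (x i / (1 - shrink n))) := by
      rw [Real.sin_arccos, Real.sqrt_pos]; nlinarith
    simp only [hωdef]
    positivity
  have hω2 : ∀ i, ω i ≤ 2 := fun i => by
    have hs := Real.sin_le_one (Real.arccos (x i / (1 - shrink n)))
    have hs0 : 0 ≤ (1 - shrink n) * (Real.pi / 2) := by positivity
    have : (1 - shrink n) * (Real.pi / 2) ≤ 2 := by nlinarith [Real.pi_le_four]
    calc ω i ≤ (1 - shrink n) * (Real.pi / 2) * 1 := mul_le_mul_of_nonneg_left hs hs0
      _ ≤ 2 := by linarith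
  have hinj : ∀ p ∈ polySpace n, (∀ i, polyFun p (x i) = 0) → p = 0 := fun p hp hz => by
    refine eq_zero_of_integral_norm_sq hp ?_
    have h := integral_norm_sq_le_discrete hn hm hx hcount hp
    simpa [hz] using h
  obtain ⟨fhat, hfit⟩ := exists_unique_isLeastSquaresFit (polySpace n) hm hω x hw hinj
    (fun i => f (x i) + e i)
  have hhat := (hfit fhat).2 rfl
  have hmpos : (0 : ℝ) < (m : ℝ)⁻¹ := by positivity
  have hnn : ∀ u : Fin m → ℂ, 0 ≤ ∑ i, ω i * ‖u i‖ ^ 2 := fun u =>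
    Finset.sum_nonneg fun i _ => mul_nonneg (hω i).le (sq_nonneg _)
  have hmin := hhat.2 q hq
  rw [lsObjective_eq_ofReal hm (fun i => (hω i).le) x hw,
    lsObjective_eq_ofReal hm (fun i => (hω i).le) x hw,
    ENNReal.ofReal_le_ofReal_iff (mul_nonneg hmpos.le (hnn _)),
    mul_le_mul_iff_right₀ hmpos] at hmin
  have hI := integral_sub_sq_le hn hm hx hcount (fun i => rfl) (fun i => (hω i).le) hω2
    (fun i => f (x i)) e hhat.1 hq hmin
  set R := errNorm uniformMeasure 2 f q with hRdef
  have hRtop : R ≠ ∞ := errNorm_ne_top hf q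
  set r := R.toReal with hr
  have hRr : R = ENNReal.ofReal r := (ENNReal.ofReal_toReal hRtop).symm
  have hr0 : 0 ≤ r := ENNReal.toReal_nonneg
  rw [lsObjective_eq_ofReal hm (fun i => (hω i).le) x hw, hRr, ← ENNReal.ofReal_pow hr0,
    ← ENNReal.ofReal_mul (by positivity), ENNReal.ofReal_le_ofReal_iff (by positivity)] at hobj
  have hs0 : 0 < √ε := Real.sqrt_pos.2 h0
  have hs1 : √ε ≤ 1 := Real.sqrt_le_one.2 h1.le
  have hsq : √ε ^ 2 = ε := Real.sq_sqrt h0.le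
  -- The squared error is at most `160 / ε · (r + ‖e‖)²` and `160 ≤ 13²`. In the `L²` bound, the
  -- triangle inequality with `f - q` raises 13 to 14.
  set B := 13 / √ε * (r + ‖e‖) with hB
  have hB0 : 0 ≤ B := by positivity
  have hIB : ∫ t in (-1 : ℝ)..1, ‖polyFun (q - fhat) t‖ ^ 2 ≤ B ^ 2 := by
    have hB2 : B ^ 2 = 169 / ε * (r + ‖e‖) ^ 2 := by
      rw [hB, mul_pow, div_pow, hsq]; norm_num
    have he1 : 1 ≤ 1 / ε := by rw [le_div_iff₀ h0]; linarith
    have he2 : ‖e‖ ^ 2 ≤ 1 / ε * ‖e‖ ^ 2 := le_mul_of_one_le_left (sq_nonneg _) he1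
    have he3 : r ^ 2 + ‖e‖ ^ 2 ≤ (r + ‖e‖) ^ 2 := by nlinarith [norm_nonneg e]
    calc _ ≤ 80 * (2 / ε * r ^ 2) + 160 * ‖e‖ ^ 2 := by linarith
      _ ≤ 160 * (1 / ε * (r ^ 2 + ‖e‖ ^ 2)) := by
          have : 80 * (2 / ε * r ^ 2) = 160 * (1 / ε * r ^ 2) := by ring
          rw [this, mul_add (1 / ε)]; linarith
      _ ≤ 160 * (1 / ε * (r + ‖e‖) ^ 2) := by gcongr
      _ ≤ 169 * (1 / ε * (r + ‖e‖) ^ 2) := by gcongr; norm_num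
      _ = B ^ 2 := by rw [hB2]; ring
  have hdiff : q - fhat ∈ polySpace n := Submodule.sub_mem _ hq hhat.1
  have h2 := eLpNorm_polyFun_le hB0 hIB
  have hinf := eLpNorm_top_polyFun_le hdiff hB0 hIB
  have hdecomp : (fun t => f t - polyFun fhat t)
      = (fun t => f t - polyFun q t) + polyFun (q - fhat) := by
    funext t
    simp [polyFun]
  have hmeas1 : AEStronglyMeasurable (fun t => f t - polyFun q t) uniformMeasure :=
    hf.1.sub (continuous_polyFun q).aestronglyMeasurable
  have hmeas2 : AEStronglyMeasurable (polyFun (q - fhat)) uniformMeasure :=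
    (continuous_polyFun _).aestronglyMeasurable
  have heE : ‖e‖ₑ = ENNReal.ofReal ‖e‖ := (ofReal_norm e).symm
  refine ⟨fhat, hfit, ?_, ?_⟩
  · calc errNorm uniformMeasure 2 f fhat ≤ R + eLpNorm (polyFun (q - fhat)) 2 uniformMeasure := by
          rw [errNorm, hdecomp]
          exact eLpNorm_add_le hmeas1 hmeas2 (by norm_num)
      _ ≤ ENNReal.ofReal r + ENNReal.ofReal B := by rw [← hRr]; exact add_le_add le_rfl h2
      _ ≤ _ := by
          rw [hRr, heE, ← ENNReal.ofReal_add hr0 hB0, ← ENNReal.ofReal_add hr0 (norm_nonneg _),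
            ← ENNReal.ofReal_mul (by positivity)]
          refine ENNReal.ofReal_le_ofReal ?_
          have h3 : 1 ≤ 1 / √ε := by rw [le_div_iff₀ hs0]; linarith
          -- The argument gives the `L²` bound with `1 / √ε`; it is weakened here to match the
          -- stated factor `n / √ε`.
          have h4 : 1 / √ε ≤ n / √ε := by gcongr
          have h5 : 13 / √ε = 13 * (1 / √ε) := by ring
          have h6 : 0 ≤ r + ‖e‖ := by positivity
          have h7 := mul_le_mul_of_nonneg_right h4 h6
          have h8 := mul_le_mul_of_nonneg_right h3 h6
          rw [hB, h5]
          linarith [norm_nonneg e]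
  · calc errNorm uniformMeasure ∞ f fhat
        ≤ errNorm uniformMeasure ∞ f q + eLpNorm (polyFun (q - fhat)) ∞ uniformMeasure := by
          rw [errNorm, hdecomp]
          exact eLpNorm_add_le hmeas1 hmeas2 (by simp)
      _ ≤ errNorm uniformMeasure ∞ f q + ENNReal.ofReal (n * B) := add_le_add le_rfl hinf
      _ ≤ _ := by
          rw [mul_add]
          refine add_le_add (le_mul_of_one_le_left zero_le (by norm_num)) ?_
          rw [hRr, heE, ← ENNReal.ofReal_add hr0 (norm_nonneg _),
            ← ENNReal.ofReal_mul (by positivity), ← ENNReal.ofReal_mul (by norm_num)]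
          refine ENNReal.ofReal_le_ofReal ?_
          have h5 : (n : ℝ) * B = 13 * (n / √ε * (r + ‖e‖)) := by rw [hB]; ring
          have h6 : 0 ≤ n / √ε * (r + ‖e‖) := by positivity
          rw [h5]
          linarith

theorem mainTheorem3 :
    ∃ (K : ℝ) (C : ℝ → ℝ), 0 < K ∧ ∀ (n : ℕ), 1 ≤ n → ∀ (ε : ℝ), 0 < ε → ε < 1 →
      ∃ m : ℕ, n ≤ m ∧ 8 * (n : ℝ) * Real.log (3 * n / ε) ≤ m ∧
        -- the expected cost
        (∀ (α A : ℝ) (c : ℝ → ℝ), 0 ≤ α → Measurable c →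
          (∀ x ∈ Ioo (-1 : ℝ) 1, 0 < c x ∧ c x ≤ A * (1 - x ^ 2) ^ (-α)) →
          (α ≠ 1 / 2 → expectedCost c (chebyshevMeasure (shrink n)) m ≤
            ENNReal.ofReal (C α * A * ((n : ℝ) ^ max 1 (2 * α) * Real.log (3 * n / ε)))) ∧
          (α = 1 / 2 → expectedCost c (chebyshevMeasure (shrink n)) m ≤
            ENNReal.ofReal (C α * A * (n * Real.log (3 * n) * Real.log (3 * n / ε))))) ∧
        -- uniqueness and error bounds, with probability at least `1 - ε`
        (∀ (f : ℝ → ℂ), MemLp f 2 uniformMeasure →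
          ∀ fn : ℂ[X], IsBestL2Approx (polySpace n) uniformMeasure f fn →
          ∃ E : Set (Fin m → ℝ), MeasurableSet E ∧
            ENNReal.ofReal (1 - ε) ≤ sampleLaw (chebyshevMeasure (shrink n)) m E ∧
            ∀ x ∈ E, ∀ e : EuclideanSpace ℂ (Fin m), ∃ fhat : ℂ[X],
              (∀ p : ℂ[X], IsLeastSquaresFit (polySpace n)
                (weightFn (chebyshevMeasure (shrink n)) uniformMeasure)
                x (fun i => f (x i) + e i) p ↔ p = fhat) ∧
              errNorm uniformMeasure 2 f fhat ≤
                ENNReal.ofReal (K * (n / √ε)) * (errNorm uniformMeasure 2 f fn + ‖e‖ₑ) ∧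
              errNorm uniformMeasure ∞ f fhat ≤
                ENNReal.ofReal K * (errNorm uniformMeasure ∞ f fn +
                  ENNReal.ofReal (n / √ε) * (errNorm uniformMeasure 2 f fn + ‖e‖ₑ))) := by
  -- `1921` bounds `m / (n L)`: rounding up adds at most `1 ≤ n L`. The factor `256 ^ α` comes from
  -- `cost_rpow_le`, the last one from the integral of `t^(-2α)`.
  refine ⟨14, fun α => if α = 1 / 2 then 1921 * 256 ^ α * 2
    else 1921 * 256 ^ α * (5 / |1 - 2 * α|), by norm_num, fun n hn ε h0 h1 => ?_⟩
  have hn' : (1 : ℝ) ≤ n := by exact_mod_cast hn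
  have hn0 : (0 : ℝ) < n := by linarith
  set L := Real.log (3 * n / ε) with hL
  have hL1 : 1 ≤ L := one_le_log hn h0 h1
  have hnL : (n : ℝ) ≤ n * L := le_mul_of_one_le_right hn0.le hL1
  set m := ⌈1920 * n * L⌉₊ with hm
  have hmlo : 1920 * n * L ≤ m := Nat.le_ceil _
  have hmup : (m : ℝ) ≤ 1921 * (n * L) := by
    have := Nat.ceil_lt_add_one (show 0 ≤ 1920 * n * L by positivity)
    linarith
  have hnm : n ≤ m := by
    have : (n : ℝ) ≤ m := by linarith
    exact_mod_cast this
  have hmpos : 0 < m := by omega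
  refine ⟨m, hnm, by linarith, ?_, ?_⟩
  · intro α A c hα hc hle
    refine ⟨fun hne => ?_, fun heq => ?_⟩
    · refine (expectedCost_chebyshev_le hn hα hc hle hmup
        (integral_rpow_le_of_ne hn hα hne)).trans (le_of_eq ?_)
      simp only [if_neg hne]
      rw [Real.rpow_sub hn0, Real.rpow_one]
      congr 1
      field_simp
    · refine (expectedCost_chebyshev_le hn hα hc hle hmup
        (integral_rpow_le_of_eq hn heq)).trans (le_of_eq ?_)
      simp only [if_pos heq]
      congr 1
      ring
  · intro f hf fn hfn
    obtain ⟨E, hE, hprob, hgood⟩ := exists_good_event hn hmpos h0 h1 hmlo hf fn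
      (errNorm_ne_top hf fn)
    refine ⟨E, hE, hprob, fun x hx e => ?_⟩
    obtain ⟨hx1, hx2, hx3, hx4⟩ := hgood x hx
    exact leastSquares_accuracy hn hmpos h0 h1 hf hfn.1 hx1 hx2 hx3 hx4 e
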